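/- **Setting.** There are $n$ individuals, each with a binary protected class $z_i\in\{0,1\}$, and a finite nonempty set $J$ of divisible items with supplies $s_j>0$. Individual $i$ has valuations $v_{ij}>0$ and utility $v_i\cdot x_i=\sum_j v_{ij}x_{ij}$. An allocation $x\ge 0$ is feasible if $\sum_i x_{ij}\le s_j$ for all $j$. For budgets $b_i>0$, an Eisenberg–Gale allocation is a feasible allocation that maximizes $\sum_i b_i\log(v_i\cdot x_i)$ (with $\log 0=-\infty$). A CEEqI (competitive equilibrium from equitable incomes) allocation is an Eisenberg–Gale allocation $x$ for budgets equal to $1$ for one class and to some $\bar B\ge 1$ for the other class, such that the average utilities $U(x)_0$ and $U(x)_1$ of the two classes are equal (this requirement is void if one class is empty). **Theorem.** (A) Suppose both classes are nonempty, and let $x$ be a CEEqI allocation with budgets $b_i\in\{1,\bar B\}$ as above. 1. *No regret.* There is exactly one price vector $p\ge 0$ such that $(x,p)$ is a market equilibrium for the budgets $b$: $\sum_i x_{ij}=s_j$ for all $j$, and for every $i$, $p\cdot x_i\le b_i$ and $v_i\cdot x_i\ge v_i\cdot y$ for all bundles $y\ge 0$ with $p\cdot y\le b_i$. 2. *No scaled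 envy.* If $i$ belongs to the class with budget $\bar B$, then $v_i\cdot x_i\ge v_i\cdot x_k$ for all individuals $k$. If $i$ belongs to the class with budget $1$, then $\bar B\,(v_i\cdot x_i)\ge v_i\cdot x_k$ for all individuals $k$. 3. *Pareto optimality.* No feasible allocation $y$ satisfies $v_i\cdot y_i\ge v_i\cdot x_i$ for all $i$ with strict inequality for some $i$. (B) *Strategy-proofness in the large.* Let $\bar v>0$, $V=(0,\bar v]^J$, and $c_j>0$ for all $j$; in a market with $n$ individuals let item $j$ have supply $c_jn$. Let $P$ be a probability distribution of (class, valuation) on $\{0,1\}\times V$ under which both classes have positive probability and the valuation has full support in $V$. Let $M$ be any measurable rule that maps every finite profile of classes and reported valuations to a CEEqI allocation for the reported valuations. Let $\sigma$ be any (possibly randomized, possibly class-dependent) reporting strategy such that the reports of individuals drawn from $P$ have full support in $V$. Then for every $\epsilon>0$ there is $\bar n$ such that for all $n>\bar n$, every individual $i$, of either class, and all $v_i,v_i'\in V$: if the other $n-1$ individuals are drawn independently from $P$ and report according to $\sigma$, then the expected (true) utility of individual $i$ with true valuation $v_i$ under $M$ from reporting $v_i'$ exceeds the expected utility from reporting $v_i$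 by at most $\epsilon$. -/

import Mathlib

open MeasureTheory ProbabilityTheory

noncomputable section

namespace FairDivision

/-- Linear utility `v · y` of a bundle `y` under the valuation vector `v`. -/
def util {J : Type*} [Fintype J] (v y : J → ℝ) : ℝ := ∑ j, v j * y j

/-- Cost of a bundle `y` at prices `p`. -/
def cost {J : Type*} [Fintype J] (p y : J → ℝ) : ℝ := ∑ j, p j * y j

/-- `x` is an allocation that respects the supplies `s`. -/
def IsFeasible {J : Type*} {n : ℕ} (s : J → ℝ) (x : Fin n → J → ℝ) : Prop :=
  (∀ i j, 0 ≤ x i j) ∧ ∀ j, ∑ i, x i j ≤ s j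

/-- Given prices `p` and budgets `b`, nobody prefers an affordable bundle to the own one. -/
def NoRegret {J : Type*} [Fintype J] {n : ℕ} (b : Fin n → ℝ) (v x : Fin n → J → ℝ)
    (p : J → ℝ) : Prop :=
  ∀ i, ∀ y : J → ℝ, (∀ j, 0 ≤ y j) → cost p y ≤ b i → util (v i) y ≤ util (v i) (x i)

/-- Market equilibrium: every individual's bundle is affordable and is a best affordable one,
and every item is exactly allocated. -/
structure IsMarketEquilibrium {J : Type*} [Fintype J] {n : ℕ} (s : J → ℝ) (b : Fin n → ℝ)
    (v x : Fin n → J → ℝ) (p : J → ℝ) : Prop where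
  alloc_nonneg : ∀ i j, 0 ≤ x i j
  price_nonneg : ∀ j, 0 ≤ p j
  affordable : ∀ i, cost p (x i) ≤ b i
  no_regret : NoRegret b v x p
  clears : ∀ j, ∑ i, x i j = s j

/-- `x` solves the Eisenberg–Gale program: maximize `∑ i, b i * log (v i · x i)` over the feasible
allocations. Allocations that give somebody utility `0` have objective value `-∞`; they are
excluded here, because the real logarithm of `0` is `0` in Mathlib. -/
def IsEisenbergGale {J : Type*} [Fintype J] {n : ℕ} (s : J → ℝ) (b : Fin n → ℝ)
    (v x : Fin n → J → ℝ) : Prop :=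
  IsFeasible s x ∧ (∀ i, 0 < util (v i) (x i)) ∧
    ∀ y : Fin n → J → ℝ, IsFeasible s y → (∀ i, 0 < util (v i) (y i)) →
      ∑ i, b i * Real.log (util (v i) (y i)) ≤ ∑ i, b i * Real.log (util (v i) (x i))

/-- Average utility of the individuals with protected class `g`. -/
def groupAvg {J : Type*} [Fintype J] {n : ℕ} (z : Fin n → Fin 2) (v x : Fin n → J → ℝ)
    (g : Fin 2) : ℝ :=
  (∑ i with z i = g, util (v i) (x i)) / (Finset.univ.filter (fun i => z i = g)).card

/-- Budgets: `B` for the members of group `g`, and `1` for everybody else. -/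
def groupBudget {n : ℕ} (z : Fin n → Fin 2) (g : Fin 2) (B : ℝ) (i : Fin n) : ℝ :=
  if z i = g then B else 1

/-- `x` is an outcome of competitive equilibrium from equitable incomes in which group `g` has
the larger budget `B ≥ 1` and the other group has budget `1`: an Eisenberg–Gale allocation for
these budgets under which both groups have the same average utility. (If only one of the groups
has members, there is nothing to equalize, and all budgets are equal.) -/
def IsCEEqI {J : Type*} [Fintype J] {n : ℕ} (s : J → ℝ) (z : Fin n → Fin 2)
    (v : Fin n → J → ℝ) (g : Fin 2) (B : ℝ) (x : Fin n → J → ℝ) : Prop :=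
  1 ≤ B ∧ IsEisenbergGale s (groupBudget z g B) v x ∧
    (Function.Surjective z → groupAvg z v x 1 = groupAvg z v x 0)

/-- Nobody can be made better off without making somebody else worse off. -/
def IsParetoOptimal {J : Type*} [Fintype J] {n : ℕ} (s : J → ℝ) (v x : Fin n → J → ℝ) : Prop :=
  IsFeasible s x ∧ ¬ ∃ y : Fin n → J → ℝ, IsFeasible s y ∧
    (∀ i, util (v i) (x i) ≤ util (v i) (y i)) ∧ ∃ i, util (v i) (x i) < util (v i) (y i)

/-- No scaled envy: the members of group `g` (with budget `B`) envy nobody, and the members of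
the other group envy nobody once their own utility is multiplied by `B`. -/
def NoScaledEnvy {J : Type*} [Fintype J] {n : ℕ} (z : Fin n → Fin 2)
    (v : Fin n → J → ℝ) (g : Fin 2) (B : ℝ) (x : Fin n → J → ℝ) : Prop :=
  (∀ i, z i = g → ∀ k, util (v i) (x k) ≤ util (v i) (x i)) ∧
    ∀ i, z i ≠ g → ∀ k, util (v i) (x k) ≤ B * util (v i) (x i)

/-- Strictly positive valuation vectors bounded by `vbar`. -/
abbrev Valuation (J : Type*) (vbar : ℝ) : Type _ :=
  {v : J → ℝ // ∀ j, 0 < v j ∧ v j ≤ vbar}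

/-- A mechanism: for each market size `n`, it maps the protected classes and reported valuations
of the `n` individuals to an allocation. -/
abbrev Mechanism (J : Type*) (vbar : ℝ) : Type _ :=
  ∀ n : ℕ, (Fin n → Fin 2 × Valuation J vbar) → Fin n → J → ℝ

/-- `M` is a (measurable) version of CEEqI for markets in which item `j` has supply `c j * n`:
it always selects a CEEqI allocation for the reported valuations. Versions differ only in how
they select one among several such allocations. -/
def IsCEEqIMechanism {J : Type*} [Fintype J] {vbar : ℝ} (c : J → ℝ) (M : Mechanism J vbar) :
    Prop :=
  ∀ n : ℕ, Measurable (M n) ∧ ∀ ω : Fin n → Fin 2 × Valuation J vbar,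
    ∃ (g : Fin 2) (B : ℝ),
      IsCEEqI (fun j => c j * n) (fun i => (ω i).1) (fun i => ((ω i).2 : J → ℝ)) g B (M n ω)

/-- Law of (protected class, report) of an individual whose class and true valuation are drawn
from `P` and who reports according to the, possibly randomized, strategy `σ`. -/
def reportLaw {J : Type*} {vbar : ℝ} (P : Measure (Fin 2 × Valuation J vbar))
    (σ : Kernel (Fin 2 × Valuation J vbar) (Valuation J vbar)) :
    Measure (Fin 2 × Valuation J vbar) :=
  (P ⊗ₘ σ).map (fun q => (q.1.1, q.2))

/-- Expected true utility of individual `i`, with protected class `z` and true valuation `v`, from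
reporting `r` in a market with `n` individuals in which the classes and reports of the other
`n - 1` individuals are independent with law `Q`. (The `i`-th coordinate that is drawn is
overwritten.) -/
def expectedUtil {J : Type*} [Fintype J] {vbar : ℝ} (M : Mechanism J vbar)
    (Q : Measure (Fin 2 × Valuation J vbar)) (n : ℕ) (i : Fin n) (z : Fin 2)
    (v r : Valuation J vbar) : ℝ :=
  ∫ ω, util (v : J → ℝ) (M n (Function.update ω i (z, r)) i) ∂(Measure.pi fun _ : Fin n => Q)

/-- Strategy-proofness in the large: for all strategies `σ` of the others whose reports have full
support and all `ε > 0`, in all sufficiently large markets nobody gains more than `ε` in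
expectation by any misreport. -/
def IsSPL {J : Type*} [Fintype J] {vbar : ℝ} (P : Measure (Fin 2 × Valuation J vbar))
    (M : Mechanism J vbar) : Prop :=
  ∀ σ : Kernel (Fin 2 × Valuation J vbar) (Valuation J vbar), IsMarkovKernel σ →
    ((reportLaw P σ).map Prod.snd).IsOpenPosMeasure →
    ∀ ε : ℝ, 0 < ε → ∃ N : ℕ, ∀ n : ℕ, N < n →
      ∀ (i : Fin n) (z : Fin 2) (v v' : Valuation J vbar),
        expectedUtil M (reportLaw P σ) n i z v v' - expectedUtil M (reportLaw P σ) n i z v v ≤ ε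

end FairDivision

end

noncomputable section

namespace FairDivision

/-! Part (A) is linear Fisher market duality. At an Eisenberg–Gale optimum, let the price of an item
be the largest marginal contribution `b k * v k j / u k` to the objective. The first-order condition
then forces revenue, spending and budgets to agree, and termwise equality yields clearing, exhausted
budgets and complementary slackness (`IsEisenbergGale.exists_isSupporting`). No regret and no scaled
envy follow because nobody gets more utility per unit of money than in the own bundle; Pareto
optimality follows because the objective is strictly increasing in utilities.

For part (B), normalise budgets so that class `1` has `r` and class `0` has `1`. A utility is then
budget times best utility per unit of money, so it depends only on `r`, the prices and the
valuation. Truthful reporting is optimal at fixed `r` and prices, so it is enough that one report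
hardly moves them.

This needs a stability argument, since the equalizing ratio and prices need not be unique. Say a
change of one report raises `r`. By monotonicity of prices in budgets (`IsSupporting.price_le`), up
to errors of order `1 / n`, everybody else in class `0` loses and everybody else in class `1` gains.
Both outcomes have equal class averages, so these opposite movements nearly cancel: the others'
absolute utility changes sum to at most a constant (`exists_sum_abs_sub_le`). On the other hand, if
`(r, p⁻¹)` moved by a fixed amount, some open set of valuations from a fixed finite family would
feel a change of at least a fixed size in either class (`exists_bestRate_ne`, made uniform by
compactness in `exists_test_family`). Full support puts linearly many individuals into that set,
which contradicts the constant bound for large `n` (`exists_forall_util_le_add`). Samples that are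
not rich enough are exponentially rare (`exists_rare_bound`), while utilities grow at most linearly
in `n`. -/

lemma util_nonneg {J : Type*} [Fintype J] {v y : J → ℝ} (hv : ∀ j, 0 ≤ v j) (hy : ∀ j, 0 ≤ y j) :
    0 ≤ util v y :=
  Finset.sum_nonneg fun j _ => mul_nonneg (hv j) (hy j)

/-! ### Eisenberg–Gale optima, supporting prices and welfare -/

/-- First-order optimality condition for the Eisenberg–Gale program. -/
lemma IsEisenbergGale.first_order {J : Type*} [Fintype J] {n : ℕ} {s : J → ℝ} {b : Fin n → ℝ}
    {v x : Fin n → J → ℝ} (h : IsEisenbergGale s b v x) (hv : ∀ i j, 0 < v i j)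
    {y : Fin n → J → ℝ} (hy : IsFeasible s y) :
    ∑ i, b i * util (v i) (y i) / util (v i) (x i) ≤ ∑ i, b i := by
  obtain ⟨⟨hx0, hxs⟩, hu, hmax⟩ := h
  set u : Fin n → ℝ := fun i => util (v i) (x i) with hu_def
  set d : Fin n → ℝ := fun i => util (v i) (y i) - u i with hd
  set φ : ℝ → ℝ := fun t => ∑ i, b i * Real.log (u i + t * d i) with hφ
  have hder : HasDerivAt φ (∑ i, b i * (d i / u i)) 0 := by
    refine HasDerivAt.fun_sum fun i _ => ?_
    have h1 : HasDerivAt (fun t : ℝ => u i + t * d i) (d i) 0 := by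
      simpa using ((hasDerivAt_id (0 : ℝ)).mul_const (d i)).const_add (u i)
    have h2 := h1.log (by simpa using (hu i).ne')
    simpa using h2.const_mul (b i)
  have hle : ∀ t ∈ Set.Ioo (0 : ℝ) 1, φ t ≤ φ 0 := by
    intro t ht
    have hutil : ∀ i, util (v i) (fun j => (1 - t) * x i j + t * y i j) = u i + t * d i := by
      intro i
      simp only [hd, hu_def, util, mul_sub, Finset.mul_sum, ← Finset.sum_sub_distrib,
        ← Finset.sum_add_distrib]
      exact Finset.sum_congr rfl fun j _ => by ring
    have hpos : ∀ i, 0 < u i + t * d i := by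
      intro i
      have h0 := util_nonneg (fun j => (hv i j).le) (hy.1 i)
      have : 0 < (1 - t) * u i := mul_pos (by linarith [ht.2]) (hu i)
      have : 0 ≤ t * util (v i) (y i) := mul_nonneg ht.1.le h0
      simp only [hd]; nlinarith
    have := hmax (fun i j => (1 - t) * x i j + t * y i j) ⟨fun i j => ?_, fun j => ?_⟩
      (fun i => by rw [hutil]; exact hpos i)
    · simpa only [hφ, hutil, zero_mul, add_zero] using this
    · exact add_nonneg (mul_nonneg (by linarith [ht.2]) (hx0 i j)) (mul_nonneg ht.1.le (hy.1 i j))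
    · rw [Finset.sum_add_distrib, ← Finset.mul_sum, ← Finset.mul_sum]
      nlinarith [hxs j, hy.2 j, ht.1, ht.2]
  have hnonpos : ∑ i, b i * (d i / u i) ≤ 0 := by
    -- Only slopes from the right are available: for negative `t` the segment from `x` towards `y`
    -- may leave the feasible set.
    have hs := (hasDerivAt_iff_tendsto_slope.1 hder).mono_left
      (nhdsWithin_mono (0 : ℝ) (s := Set.Ioi 0) fun t (ht : 0 < t) => ht.ne')
    refine le_of_tendsto hs ?_
    filter_upwards [Ioo_mem_nhdsGT (zero_lt_one' ℝ)] with t ht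
    rw [slope_def_field]
    exact div_nonpos_of_nonpos_of_nonneg (by linarith [hle t ht]) (by linarith [ht.1])
  have : ∀ i, b i * (d i / u i) = b i * util (v i) (y i) / u i - b i := by
    intro i
    have := (hu i).ne'
    simp only [hd]
    rw [mul_div_assoc, sub_div, div_self (hu i).ne']
    ring
  simp only [this, Finset.sum_sub_distrib] at hnonpos
  linarith

/-- Prices `p` supporting the allocation `x` in a linear Fisher market: everybody spends the whole
budget, and only on items of maximal value per unit of money. -/
structure IsSupporting {J : Type*} [Fintype J] {n : ℕ} (s : J → ℝ) (b : Fin n → ℝ)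
    (v x : Fin n → J → ℝ) (p : J → ℝ) : Prop where
  alloc_nonneg : ∀ i j, 0 ≤ x i j
  util_pos : ∀ i, 0 < util (v i) (x i)
  price_pos : ∀ j, 0 < p j
  rate_le : ∀ i j, b i * v i j ≤ p j * util (v i) (x i)
  rate_eq : ∀ i j, 0 < x i j → b i * v i j = p j * util (v i) (x i)
  clears : ∀ j, ∑ i, x i j = s j
  cost_eq : ∀ i, cost p (x i) = b i

lemma IsSupporting.revenue {J : Type*} [Fintype J] {n : ℕ} {s : J → ℝ} {b : Fin n → ℝ}
    {v x : Fin n → J → ℝ} {p : J → ℝ} (h : IsSupporting s b v x p) :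
    ∑ j, p j * s j = ∑ i, b i := by
  simp_rw [← h.clears, ← h.cost_eq, cost, Finset.mul_sum]
  exact Finset.sum_comm

/-- Two opposite bounds meet. Handing each item to an individual with the largest marginal
contribution and applying the first-order condition bounds revenue by total budgets. Conversely,
every budget is the value of the own bundle at the own marginal contributions, hence at most its
cost. Equality then holds in every summand. -/
lemma IsEisenbergGale.exists_isSupporting {J : Type*} [Fintype J] {n : ℕ} [NeZero n] {s : J → ℝ}
    {b : Fin n → ℝ} {v x : Fin n → J → ℝ} (h : IsEisenbergGale s b v x) (hs : ∀ j, 0 < s j)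
    (hb : ∀ i, 0 < b i) (hv : ∀ i j, 0 < v i j) : ∃ p, IsSupporting s b v x p := by
  classical
  have hu := h.2.1
  set u : Fin n → ℝ := fun i => util (v i) (x i) with hu_def
  have hbest : ∀ j, ∃ i, ∀ k, b k * v k j / u k ≤ b i * v i j / u i := fun j =>
    Finite.exists_max fun k => b k * v k j / u k
  choose m hm using hbest
  set p : J → ℝ := fun j => b (m j) * v (m j) j / u (m j) with hp
  have hp0 : ∀ j, 0 < p j := fun j => div_pos (mul_pos (hb _) (hv _ _)) (hu _)
  have hle : ∀ i j, b i * v i j / u i ≤ p j := fun i j => hm j i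
  have hrev : ∑ j, p j * s j ≤ ∑ i, b i := by
    have := h.first_order hv (y := fun i j => if m j = i then s j else 0)
      ⟨fun i j => by dsimp only; split_ifs; exacts [(hs j).le, le_rfl], fun j => by simp⟩
    refine le_trans (le_of_eq ?_) this
    simp only [util, Finset.mul_sum, Finset.sum_div]
    rw [Finset.sum_comm]
    refine Finset.sum_congr rfl fun j _ => ?_
    rw [Finset.sum_eq_single (m j)]
    · simp only [hp, if_true, hu_def, util]; ring
    · intro i _ hi; simp [hi.symm]
    · simp
  have hbud : ∀ i, ∑ j, b i * v i j / u i * x i j = b i := by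
    intro i
    have : ∑ j, b i * v i j / u i * x i j = b i / u i * u i := by
      simp only [hu_def, util, Finset.mul_sum]
      exact Finset.sum_congr rfl fun j _ => by ring
    rw [this, div_mul_cancel₀ _ (hu i).ne']
  have hterm : ∀ i j, b i * v i j / u i * x i j ≤ p j * x i j := fun i j =>
    mul_le_mul_of_nonneg_right (hle i j) (h.1.1 i j)
  have hsup : ∀ j, ∑ i, p j * x i j ≤ p j * s j := fun j => by
    rw [← Finset.mul_sum]; exact mul_le_mul_of_nonneg_left (h.1.2 j) (hp0 j).le
  have hcomm : ∑ i, ∑ j, p j * x i j = ∑ j, ∑ i, p j * x i j := Finset.sum_comm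
  have hA' : ∀ i, b i ≤ ∑ j, p j * x i j := fun i =>
    (hbud i).symm.le.trans (Finset.sum_le_sum fun j _ => hterm i j)
  have hA : ∑ i, b i ≤ ∑ i, ∑ j, p j * x i j := Finset.sum_le_sum fun i _ => hA' i
  have hB : ∑ j, ∑ i, p j * x i j ≤ ∑ j, p j * s j := Finset.sum_le_sum fun j _ => hsup j
  -- The chain budgets ≤ spending ≤ revenue ≤ budgets has closed, so each inequality is now read as
  -- a termwise equality.
  have hclear : ∀ j, ∑ i, x i j = s j := by
    have := (Finset.sum_eq_sum_iff_of_le fun j _ => hsup j).1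
      (le_antisymm hB (by linarith))
    intro j
    have hj := this j (Finset.mem_univ j)
    rw [← Finset.mul_sum] at hj
    exact mul_left_cancel₀ (hp0 j).ne' hj
  have hcost : ∀ i, cost p (x i) = b i := by
    have := (Finset.sum_eq_sum_iff_of_le fun i _ => hA' i).1 (le_antisymm hA (by linarith))
    exact fun i => (this i (Finset.mem_univ i)).symm
  refine ⟨p, h.1.1, hu, hp0, fun i j => ?_, fun i j hij => ?_, hclear, hcost⟩
  · exact (div_le_iff₀ (hu i)).1 (hle i j)
  · have := (Finset.sum_eq_sum_iff_of_le fun j _ => hterm i j).1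
      ((hbud i).trans (hcost i).symm) j (Finset.mem_univ j)
    exact (div_eq_iff (hu i).ne').1 (mul_right_cancel₀ hij.ne' this)

/-- No item yields more than `util (v i) (x i) / b i` per unit of money. The factor `t = 1` gives no
regret, and `t = B` gives the scaled envy bound. -/
lemma IsSupporting.util_le {J : Type*} [Fintype J] {n : ℕ} {s : J → ℝ} {b : Fin n → ℝ}
    {v x : Fin n → J → ℝ} {p : J → ℝ} (h : IsSupporting s b v x p) {i : Fin n} (hb : 0 < b i)
    {y : J → ℝ} (hy : ∀ j, 0 ≤ y j) {t : ℝ} (hc : cost p y ≤ t * b i) :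
    util (v i) y ≤ t * util (v i) (x i) := by
  have h1 : b i * util (v i) y ≤ cost p y * util (v i) (x i) := by
    rw [util, cost, Finset.mul_sum, Finset.sum_mul]
    refine Finset.sum_le_sum fun j _ => ?_
    calc b i * (v i j * y j) = b i * v i j * y j := by ring
      _ ≤ p j * util (v i) (x i) * y j := mul_le_mul_of_nonneg_right (h.rate_le i j) (hy j)
      _ = _ := by ring
  have h2 := mul_le_mul_of_nonneg_right hc (h.util_pos i).le
  refine le_of_mul_le_mul_left ?_ hb
  calc _ ≤ _ := h1
    _ ≤ _ := h2
    _ = _ := by ring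

lemma IsSupporting.isMarketEquilibrium {J : Type*} [Fintype J] {n : ℕ} {s : J → ℝ}
    {b : Fin n → ℝ} {v x : Fin n → J → ℝ} {p : J → ℝ} (h : IsSupporting s b v x p)
    (hb : ∀ i, 0 < b i) : IsMarketEquilibrium s b v x p where
  alloc_nonneg := h.alloc_nonneg
  price_nonneg j := (h.price_pos j).le
  affordable i := (h.cost_eq i).le
  no_regret i y hy hc := by simpa using h.util_le (hb i) hy (t := 1) (by simpa using hc)
  clears := h.clears

/-- Competing prices are positive, since a free item would allow unbounded utility. Each item has a
holder, and if this holder could gain nothing by spending the whole budget on the item at `q`, then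
`p j ≤ q j`. Revenue at `q` is at most the total budget, which is the revenue at `p`, so no
inequality is strict. -/
lemma IsSupporting.price_unique {J : Type*} [Fintype J] {n : ℕ} [NeZero n] {s : J → ℝ}
    {b : Fin n → ℝ} {v x : Fin n → J → ℝ} {p q : J → ℝ} (h : IsSupporting s b v x p)
    (hb : ∀ i, 0 < b i) (hs : ∀ j, 0 < s j) (hv : ∀ i j, 0 < v i j)
    (hq : IsMarketEquilibrium s b v x q) : q = p := by
  classical
  have hutil : ∀ i j (t : ℝ), util (v i) (fun k => if k = j then t else 0) = v i j * t := by
    intro i j t; simp [util]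
  have hcost : ∀ j (t : ℝ), cost q (fun k => if k = j then t else 0) = q j * t := by
    intro j t; simp [cost]
  have hnr : ∀ i j (t : ℝ), 0 ≤ t → q j * t ≤ b i → v i j * t ≤ util (v i) (x i) := by
    intro i j t ht hle
    have := hq.no_regret i (fun k => if k = j then t else 0)
      (fun k => by split_ifs; exacts [ht, le_rfl]) (by rwa [hcost])
    rwa [hutil] at this
  have hq0 : ∀ j, 0 < q j := by
    intro j
    refine lt_of_le_of_ne (hq.price_nonneg j) fun h0 => ?_
    have hu := h.util_pos 0
    have := hnr 0 j ((util (v 0) (x 0) + 1) / v 0 j) (by have := hv 0 j; positivity)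
      (by rw [← h0, zero_mul]; exact (hb 0).le)
    rw [mul_div_cancel₀ _ (hv 0 j).ne'] at this
    linarith
  have hpq : ∀ j, p j ≤ q j := by
    intro j
    have : 0 < ∑ i, x i j := by rw [h.clears]; exact hs j
    obtain ⟨i, -, hi⟩ := (Finset.sum_pos_iff_of_nonneg fun i _ => h.alloc_nonneg i j).1 this
    have h1 := hnr i j (b i / q j) (div_nonneg (hb i).le (hq0 j).le)
      (by rw [mul_div_cancel₀ _ (hq0 j).ne'])
    rw [← mul_div_assoc, div_le_iff₀ (hq0 j), mul_comm (v i j), h.rate_eq i j hi,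
      mul_comm (util _ _)] at h1
    exact le_of_mul_le_mul_right h1 (h.util_pos i)
  have hrev : ∑ j, q j * s j ≤ ∑ j, p j * s j := by
    rw [h.revenue]
    simp_rw [← hq.clears, Finset.mul_sum]
    rw [Finset.sum_comm]
    exact Finset.sum_le_sum fun i _ => hq.affordable i
  have hle : ∀ j ∈ Finset.univ, p j * s j ≤ q j * s j := fun j _ =>
    mul_le_mul_of_nonneg_right (hpq j) (hs j).le
  have := (Finset.sum_eq_sum_iff_of_le hle).1 (le_antisymm (Finset.sum_le_sum hle) hrev)
  funext j
  exact (mul_right_cancel₀ (hs j).ne' (this j (Finset.mem_univ j))).symm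

lemma IsEisenbergGale.isParetoOptimal {J : Type*} [Fintype J] {n : ℕ} {s : J → ℝ}
    {b : Fin n → ℝ} {v x : Fin n → J → ℝ} (h : IsEisenbergGale s b v x) (hb : ∀ i, 0 < b i) :
    IsParetoOptimal s v x := by
  refine ⟨h.1, ?_⟩
  rintro ⟨y, hy, hle, i, hi⟩
  refine (h.2.2 y hy fun k => (h.2.1 k).trans_le (hle k)).not_gt ?_
  exact Finset.sum_lt_sum
    (fun k _ => mul_le_mul_of_nonneg_left (Real.log_le_log (h.2.1 k) (hle k)) (hb k).le)
    ⟨i, Finset.mem_univ i, mul_lt_mul_of_pos_left (Real.log_lt_log (h.2.1 i) hi) (hb i)⟩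

lemma groupBudget_pos {n : ℕ} (z : Fin n → Fin 2) (g : Fin 2) {B : ℝ} (hB : 0 < B) (i : Fin n) :
    0 < groupBudget z g B i := by
  unfold groupBudget; split_ifs; exacts [hB, one_pos]

lemma IsSupporting.noScaledEnvy {J : Type*} [Fintype J] {n : ℕ} {s : J → ℝ} {z : Fin n → Fin 2}
    {g : Fin 2} {B : ℝ} {v x : Fin n → J → ℝ} {p : J → ℝ}
    (h : IsSupporting s (groupBudget z g B) v x p) (hB : 1 ≤ B) : NoScaledEnvy z v g B x := by
  have hB0 : 0 < B := by linarith
  have hcost : ∀ k, cost p (x k) ≤ B := fun k => by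
    rw [h.cost_eq, groupBudget]; split_ifs; exacts [le_rfl, hB]
  refine ⟨fun i hi k => ?_, fun i hi k => ?_⟩
  · simpa using h.util_le (groupBudget_pos z g hB0 i) (h.alloc_nonneg k) (t := 1)
      (by simpa [groupBudget, hi] using hcost k)
  · exact h.util_le (groupBudget_pos z g hB0 i) (h.alloc_nonneg k)
      (by simpa [groupBudget, hi] using hcost k)

theorem IsCEEqI.welfare {J : Type*} [Fintype J] {n : ℕ} {s : J → ℝ} {z : Fin n → Fin 2}
    {v : Fin n → J → ℝ} {g : Fin 2} {B : ℝ} {x : Fin n → J → ℝ} (h : IsCEEqI s z v g B x)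
    (hs : ∀ j, 0 < s j) (hz : Function.Surjective z) (hv : ∀ i j, 0 < v i j) :
    (∃! p : J → ℝ, IsMarketEquilibrium s (groupBudget z g B) v x p) ∧
      NoScaledEnvy z v g B x ∧ IsParetoOptimal s v x := by
  have hb := groupBudget_pos z g (zero_lt_one.trans_le h.1)
  have : NeZero n := ⟨by rintro rfl; obtain ⟨i, -⟩ := hz 0; exact i.elim0⟩
  obtain ⟨p, hp⟩ := h.2.1.exists_isSupporting hs hb hv
  exact ⟨⟨p, hp.isMarketEquilibrium hb, fun q hq => hp.price_unique hb hs hv hq⟩,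
    hp.noScaledEnvy h.1, h.2.1.isParetoOptimal hb⟩

/-! ### Utility as budget times best rate -/

/-- Best utility per unit of money for the valuation `v`, when a unit of money buys `w j` units of
item `j`. -/
def bestRate {J : Type*} [Fintype J] [Nonempty J] (w v : J → ℝ) : ℝ :=
  Finset.univ.sup' Finset.univ_nonempty fun j => v j * w j

lemma le_bestRate {J : Type*} [Fintype J] [Nonempty J] (w v : J → ℝ) (j : J) :
    v j * w j ≤ bestRate w v :=
  Finset.le_sup' (fun j => v j * w j) (Finset.mem_univ j)

lemma bestRate_le {J : Type*} [Fintype J] [Nonempty J] {w v : J → ℝ} {t : ℝ}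
    (h : ∀ j, v j * w j ≤ t) : bestRate w v ≤ t :=
  Finset.sup'_le _ _ fun j _ => h j

lemma bestRate_le_mul {J : Type*} [Fintype J] [Nonempty J] {w w' v : J → ℝ} {t : ℝ} (ht : 0 ≤ t)
    (hv : ∀ j, 0 ≤ v j) (h : ∀ j, w j ≤ t * w' j) : bestRate w v ≤ t * bestRate w' v :=
  bestRate_le fun j => calc
    v j * w j ≤ v j * (t * w' j) := mul_le_mul_of_nonneg_left (h j) (hv j)
    _ = t * (v j * w' j) := by ring
    _ ≤ t * bestRate w' v := mul_le_mul_of_nonneg_left (le_bestRate w' v j) ht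

lemma bestRate_pos {J : Type*} [Fintype J] [Nonempty J] {w v : J → ℝ} (hw : ∀ j, 0 < w j)
    (hv : ∀ j, 0 < v j) : 0 < bestRate w v :=
  (mul_pos (hv (Classical.arbitrary J)) (hw _)).trans_le (le_bestRate w v _)

lemma util_le_bestRate_mul_cost {J : Type*} [Fintype J] [Nonempty J] {p v y : J → ℝ}
    (hp : ∀ j, 0 < p j) (hy : ∀ j, 0 ≤ y j) : util v y ≤ bestRate p⁻¹ v * cost p y := by
  rw [util, cost, Finset.mul_sum]
  refine Finset.sum_le_sum fun j _ => ?_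
  have := le_bestRate p⁻¹ v j
  rw [Pi.inv_apply, ← div_eq_mul_inv, div_le_iff₀ (hp j)] at this
  rw [← mul_assoc]
  exact mul_le_mul_of_nonneg_right this (hy j)

/-- This removes the allocation from the analysis: the choice among several optimal bundles has no
effect on utility. -/
lemma IsSupporting.util_eq {J : Type*} [Fintype J] [Nonempty J] {n : ℕ} {s : J → ℝ}
    {b : Fin n → ℝ} {v x : Fin n → J → ℝ} {p : J → ℝ} (h : IsSupporting s b v x p)
    {i : Fin n} (hb : 0 < b i) : util (v i) (x i) = b i * bestRate p⁻¹ (v i) := by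
  refine le_antisymm ?_ ?_
  · have := util_le_bestRate_mul_cost (v := v i) h.price_pos (h.alloc_nonneg i)
    rwa [h.cost_eq, mul_comm] at this
  · rw [← le_div_iff₀' hb]
    refine bestRate_le fun j => ?_
    rw [Pi.inv_apply, ← div_eq_mul_inv, div_le_div_iff₀ (h.price_pos j) hb]
    linarith [h.rate_le i j]

lemma IsSupporting.smul {J : Type*} [Fintype J] {n : ℕ} {s : J → ℝ} {b : Fin n → ℝ}
    {v x : Fin n → J → ℝ} {p : J → ℝ} (h : IsSupporting s b v x p) {t : ℝ} (ht : 0 < t) :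
    IsSupporting s (fun i => t * b i) v x (fun j => t * p j) where
  alloc_nonneg := h.alloc_nonneg
  util_pos := h.util_pos
  price_pos j := mul_pos ht (h.price_pos j)
  rate_le i j := by
    rw [mul_assoc, mul_assoc]; exact mul_le_mul_of_nonneg_left (h.rate_le i j) ht.le
  rate_eq i j hij := by rw [mul_assoc, mul_assoc, h.rate_eq i j hij]
  clears := h.clears
  cost_eq i := by rw [← h.cost_eq i, cost, cost, Finset.mul_sum]; simp_rw [mul_assoc]

/-! ### Monotonicity of prices in budgets -/

/-- Equilibrium prices of linear Fisher markets are monotone in the budgets, up to an error caused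
by a single individual `i` for whom nothing is assumed. -/
lemma IsSupporting.price_le {J : Type*} [Fintype J] {n : ℕ} {s : J → ℝ}
    {b b' : Fin n → ℝ} {v v' x x' : Fin n → J → ℝ} {p p' : J → ℝ} (h : IsSupporting s b v x p)
    (h' : IsSupporting s b' v' x' p') (i : Fin n) (hb : ∀ k, 0 < b k)
    (hv : ∀ k, k ≠ i → v' k = v k) (hbb : ∀ k, k ≠ i → b k ≤ b' k) {m : ℝ} (hm : 0 < m)
    (hms : ∀ j, m ≤ p' j * s j) (j : J) : p j ≤ (1 + b i / m) * p' j := by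
  classical
  have : Nonempty J := ⟨j⟩
  obtain ⟨j₀, hj₀⟩ := Finite.exists_max fun j => p j / p' j
  set l : ℝ := p j₀ / p' j₀ with hl
  have hle : ∀ j, p j ≤ l * p' j := fun j => (div_le_iff₀ (h'.price_pos j)).1 (hj₀ j)
  suffices hsuff : l ≤ 1 + b i / m from
    (hle j).trans (mul_le_mul_of_nonneg_right hsuff (h'.price_pos j).le)
  by_cases hl1 : l ≤ 1
  · have := div_pos (hb i) hm; linarith
  push Not at hl1
  -- The items whose price ratio is largest: relative to all others they are cheapest at `p'`.
  set S : Finset J := Finset.univ.filter fun j => p j = l * p' j with hS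
  have hj₀S : j₀ ∈ S := by
    simp only [hS, Finset.mem_filter, Finset.mem_univ, true_and, hl]
    rw [div_mul_cancel₀ _ (h'.price_pos j₀).ne']
  have hsub : ∀ k, ∑ j ∈ S, p j * x k j ≤ b k := fun k => by
    rw [← h.cost_eq k, cost]
    exact Finset.sum_le_sum_of_subset_of_nonneg (Finset.subset_univ S) fun j _ _ =>
      mul_nonneg (h.price_pos j).le (h.alloc_nonneg k j)
  have hnn : ∀ k, 0 ≤ ∑ j ∈ S, p' j * x' k j := fun k =>
    Finset.sum_nonneg fun j _ => mul_nonneg (h'.price_pos j).le (h'.alloc_nonneg k j)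
  have key : ∀ k, ∑ j ∈ S, p j * x k j ≤ ∑ j ∈ S, p' j * x' k j + if k = i then b i else 0 := by
    intro k
    by_cases hki : k = i
    · subst hki
      have := hsub k
      have := hnn k
      simp only [if_true]; linarith
    simp only [hki, if_false, add_zero]
    by_cases hex : ∃ j ∈ S, 0 < x k j
    · obtain ⟨j₁, hj₁, hx⟩ := hex
      have hbk' : 0 < b' k := (hb k).trans_le (hbb k hki)
      -- Whoever buys from `S` at `p` finds an item of `S` optimal there, so at `p'` every item
      -- outside `S` is strictly worse. The whole budget `b' k ≥ b k` then goes to `S`.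
      have hzero : ∀ l' ∈ Finset.univ, l' ∉ S → p' l' * x' k l' = 0 := by
        intro l' _ hl'
        by_contra hne
        have hx' : 0 < x' k l' := lt_of_le_of_ne (h'.alloc_nonneg k l') fun h0 =>
          hne (by rw [← h0, mul_zero])
        have hlt : p l' < l * p' l' := lt_of_le_of_ne (hle l') fun h0 =>
          hl' (by simp [hS, h0])
        have e1 := h.rate_eq k j₁ hx
        rw [(Finset.mem_filter.1 hj₁).2] at e1
        have e2 := h'.rate_le k j₁
        have e3 := h'.rate_eq k l' hx'
        have e4 := h.rate_le k l'
        rw [hv k hki] at e2 e3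
        set u := util (v k) (x k)
        set u' := util (v k) (x' k)
        have hu : 0 < u := h.util_pos k
        have f1 : l * u * b' k ≤ u' * b k := by
          refine le_of_mul_le_mul_left ?_ (h'.price_pos j₁)
          calc p' j₁ * (l * u * b' k) = (l * p' j₁ * u) * b' k := by ring
            _ = b' k * v k j₁ * b k := by rw [← e1]; ring
            _ ≤ p' j₁ * u' * b k := mul_le_mul_of_nonneg_right e2 (hb k).le
            _ = _ := by ring
        have f2 : u' * b k < l * u * b' k := by
          refine lt_of_mul_lt_mul_left ?_ (h'.price_pos l').le
          calc p' l' * (u' * b k) = (p' l' * u') * b k := by ring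
            _ = b k * v k l' * b' k := by rw [← e3]; ring
            _ ≤ p l' * u * b' k := mul_le_mul_of_nonneg_right e4 hbk'.le
            _ < l * p' l' * u * b' k :=
              mul_lt_mul_of_pos_right (mul_lt_mul_of_pos_right hlt hu) hbk'
            _ = _ := by ring
        linarith
      rw [Finset.sum_subset (Finset.subset_univ S) hzero]
      exact ((hsub k).trans (hbb k hki)).trans (h'.cost_eq k).ge
    · push Not at hex
      refine le_trans (le_of_eq (Finset.sum_eq_zero fun j hj => ?_)) (hnn k)
      rw [le_antisymm (hex j hj) (h.alloc_nonneg k j), mul_zero]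
  -- By clearing, the sum reads `l * P ≤ P + b i`, where `P` is the value of `S` at `p'` and `P ≥
  -- m`.
  have hsum := Finset.sum_le_sum fun k (_ : k ∈ Finset.univ) => key k
  rw [Finset.sum_add_distrib, Finset.sum_comm, Finset.sum_comm (f := fun k j => p' j * x' k j)]
    at hsum
  simp only [← Finset.mul_sum, h.clears, h'.clears, Finset.sum_ite_eq', Finset.mem_univ, if_true]
    at hsum
  have hSl : ∑ j ∈ S, p j * s j = l * ∑ j ∈ S, p' j * s j := by
    rw [Finset.mul_sum]
    exact Finset.sum_congr rfl fun j hj => by rw [(Finset.mem_filter.1 hj).2, mul_assoc]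
  have hmS : m ≤ ∑ j ∈ S, p' j * s j :=
    (hms j₀).trans (Finset.single_le_sum (f := fun j => p' j * s j)
      (fun j _ => hm.le.trans (hms j)) hj₀S)
  rw [hSl] at hsum
  have h3 : (l - 1) * m ≤ b i :=
    (mul_le_mul_of_nonneg_left hmS (by linarith)).trans (by linarith)
  have := (le_div_iff₀ hm).2 h3
  linarith

/-! ### Uniform bounds on equalized equilibria -/

/-- Supporting prices of a market with supplies `c j * n`, in which group `1` has budget `r`,
group `0` has budget `1`, and both groups have the same average utility. -/
structure IsEqualized {J : Type*} [Fintype J] {n : ℕ} (c : J → ℝ) (z : Fin n → Fin 2)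
    (v : Fin n → J → ℝ) (r : ℝ) (x : Fin n → J → ℝ) (p : J → ℝ) : Prop where
  supporting : IsSupporting (fun j => c j * n) (groupBudget z 1 r) v x p
  ratio_pos : 0 < r
  avg_eq : groupAvg z v x 1 = groupAvg z v x 0

/-- A fraction at least `a` of all individuals belongs to group `g` and values every item at
least at `δ`, for both groups `g`. -/
def IsSpread {J : Type*} {n : ℕ} (a δ : ℝ) (z : Fin n → Fin 2) (v : Fin n → J → ℝ) : Prop :=
  ∀ g, ∃ A : Finset (Fin n), a * n ≤ A.card ∧ ∀ k ∈ A, z k = g ∧ ∀ j, δ ≤ v k j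

lemma IsSpread.le_card {J : Type*} {n : ℕ} {a δ : ℝ} {z : Fin n → Fin 2} {v : Fin n → J → ℝ}
    (h : IsSpread a δ z v) (g : Fin 2) : a * n ≤ (Finset.univ.filter fun i => z i = g).card := by
  obtain ⟨A, hA, hAg⟩ := h g
  refine hA.trans (Nat.cast_le.2 (Finset.card_le_card fun k hk => ?_))
  simp [(hAg k hk).1]

lemma card_group_le {n : ℕ} (z : Fin n → Fin 2) (g : Fin 2) :
    ((Finset.univ.filter fun i => z i = g).card : ℝ) ≤ n := by
  exact_mod_cast (Finset.card_le_univ _).trans (Fintype.card_fin n).le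

lemma sum_group_eq {J : Type*} [Fintype J] {n : ℕ} {z : Fin n → Fin 2} {g : Fin 2}
    (v x : Fin n → J → ℝ) (h : 0 < ((Finset.univ.filter fun i => z i = g).card : ℝ)) :
    ∑ i with z i = g, util (v i) (x i) =
      (Finset.univ.filter fun i => z i = g).card * groupAvg z v x g := by
  rw [groupAvg, mul_div_cancel₀ _ h.ne']

/-- With `W` the largest inverse price, the average utility of a class with budget `β` lies between
`a * β * δ * W` and `β * vbar * W`. Equal averages bound the budget ratio by `R₁`. The limited total
supply bounds `W` by `R₂`, and revenue bounds the prices by `R₃`. -/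
lemma exists_equalized_bounds {J : Type*} [Fintype J] [Nonempty J] {c : J → ℝ}
    (hc : ∀ j, 0 < c j) {vbar a δ : ℝ} (hvbar : 0 < vbar) (ha : 0 < a) (hδ : 0 < δ) :
    ∃ R : ℝ, 1 ≤ R ∧ ∀ (n : ℕ) (z : Fin n → Fin 2) (v : Fin n → J → ℝ) (r : ℝ)
      (x : Fin n → J → ℝ) (p : J → ℝ), 0 < n → IsEqualized c z v r x p → IsSpread a δ z v →
      (∀ i j, 0 < v i j ∧ v i j ≤ vbar) → (R⁻¹ ≤ r ∧ r ≤ R) ∧ ∀ j, R⁻¹ ≤ p⁻¹ j ∧ p⁻¹ j ≤ R := by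
  classical
  set R₁ : ℝ := max 1 (vbar / (a * δ)) with hR₁
  set R₂ : ℝ := vbar * (∑ j, c j) / (a * δ) with hR₂
  set R₃ : ℝ := ∑ j, R₁ / c j with hR₃
  have hR₁1 : 1 ≤ R₁ := le_max_left _ _
  refine ⟨max R₁ (max R₂ R₃), hR₁1.trans (le_max_left _ _), ?_⟩
  set R : ℝ := max R₁ (max R₂ R₃) with hR
  have hR1 : R₁ ≤ R := le_max_left _ _
  have hR2 : R₂ ≤ R := (le_max_left _ _).trans (le_max_right _ _)
  have hR3 : R₃ ≤ R := (le_max_right _ _).trans (le_max_right _ _)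
  have hR0 : 0 < R := by linarith
  intro n z v r x p hn h hspread hv
  have hn' : (0 : ℝ) < n := Nat.cast_pos.2 hn
  have hs := h.supporting
  have hbp := groupBudget_pos z 1 h.ratio_pos
  obtain ⟨j₀, hj₀⟩ := Finite.exists_max fun j => p⁻¹ j
  set W : ℝ := p⁻¹ j₀ with hW
  have hW0 : 0 < W := inv_pos.2 (hs.price_pos j₀)
  have hup : ∀ k, util (v k) (x k) ≤ groupBudget z 1 r k * (vbar * W) := fun k => by
    rw [hs.util_eq (hbp k)]
    refine mul_le_mul_of_nonneg_left (bestRate_le fun j => ?_) (hbp k).le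
    exact mul_le_mul (hv k j).2 (hj₀ j) (inv_pos.2 (hs.price_pos j)).le hvbar.le
  have hlow : ∀ k, (∀ j, δ ≤ v k j) → groupBudget z 1 r k * (δ * W) ≤ util (v k) (x k) :=
    fun k hk => by
      rw [hs.util_eq (hbp k)]
      refine mul_le_mul_of_nonneg_left ?_ (hbp k).le
      exact (mul_le_mul_of_nonneg_right (hk j₀) hW0.le).trans (le_bestRate p⁻¹ (v k) j₀)
  have hsumlow : ∀ g β, 0 < β → (∀ k, z k = g → groupBudget z 1 r k = β) →
      a * n * (β * (δ * W)) ≤ ∑ i with z i = g, util (v i) (x i) := by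
    intro g β hβ hβk
    obtain ⟨A, hA, hAg⟩ := hspread g
    calc a * n * (β * (δ * W)) ≤ A.card * (β * (δ * W)) :=
          mul_le_mul_of_nonneg_right hA (by positivity)
      _ = ∑ k ∈ A, β * (δ * W) := by rw [Finset.sum_const, nsmul_eq_mul]
      _ ≤ ∑ k ∈ A, util (v k) (x k) := Finset.sum_le_sum fun k hk => by
          rw [← hβk k (hAg k hk).1]; exact hlow k (hAg k hk).2
      _ ≤ _ := Finset.sum_le_sum_of_subset_of_nonneg
          (fun k hk => by simp [(hAg k hk).1]) fun k _ _ => (hs.util_pos k).le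
  have hcard : ∀ g, 0 < ((Finset.univ.filter fun i => z i = g).card : ℝ) := fun g =>
    (mul_pos ha hn').trans_le (hspread.le_card g)
  have havg : ∀ g β, 0 < β → (∀ k, z k = g → groupBudget z 1 r k = β) →
      a * (β * (δ * W)) ≤ groupAvg z v x g ∧ groupAvg z v x g ≤ β * (vbar * W) := by
    intro g β hβ hβk
    constructor
    · rw [groupAvg, le_div_iff₀ (hcard g)]
      refine le_trans ?_ (hsumlow g β hβ hβk)
      have : 0 < a * (β * (δ * W)) := by positivity
      nlinarith [card_group_le z g]
    · rw [groupAvg, div_le_iff₀ (hcard g), mul_comm, ← nsmul_eq_mul]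
      refine Finset.sum_le_card_nsmul _ _ _ fun k hk => ?_
      rw [← hβk k (Finset.mem_filter.1 hk).2]
      exact hup k
  have hg1 : ∀ k, z k = 1 → groupBudget z 1 r k = r := fun k hk => by simp [groupBudget, hk]
  have hg0 : ∀ k, z k = 0 → groupBudget z 1 r k = 1 := fun k hk => by simp [groupBudget, hk]
  have h1 := havg 1 r h.ratio_pos hg1
  have h0 := havg 0 1 one_pos hg0
  have haδ : 0 < a * δ := mul_pos ha hδ
  have hr1 : r ≤ R₁ := by
    refine le_trans ?_ (le_max_right _ _)
    rw [le_div_iff₀ haδ]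
    refine le_of_mul_le_mul_right ?_ hW0
    have := h1.1.trans (h.avg_eq.trans_le h0.2)
    linarith
  have hr2 : R₁⁻¹ ≤ r := by
    refine inv_le_of_inv_le₀ h.ratio_pos (le_trans ?_ (le_max_right _ _))
    rw [inv_eq_one_div, div_le_div_iff₀ h.ratio_pos haδ]
    refine le_of_mul_le_mul_right ?_ hW0
    have := h0.1.trans (h.avg_eq.symm.trans_le h1.2)
    linarith
  have hWR : W ≤ R₂ := by
    rw [le_div_iff₀ haδ]
    refine le_of_mul_le_mul_right ?_ hn'
    have e1 := hsumlow 0 1 one_pos hg0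
    have e2 : ∑ i with z i = 0, util (v i) (x i) ≤ ∑ i, util (v i) (x i) :=
      Finset.sum_le_sum_of_subset_of_nonneg (Finset.filter_subset _ _)
        fun k _ _ => (hs.util_pos k).le
    have e3 : ∑ i, util (v i) (x i) ≤ ∑ i, ∑ j, vbar * x i j :=
      Finset.sum_le_sum fun i _ => Finset.sum_le_sum fun j _ =>
        mul_le_mul_of_nonneg_right (hv i j).2 (hs.alloc_nonneg i j)
    have e4 : ∑ i, ∑ j, vbar * x i j = vbar * (∑ j, c j) * n := by
      rw [Finset.sum_comm]
      simp_rw [← Finset.mul_sum, hs.clears, ← Finset.sum_mul, mul_assoc]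
    linarith
  refine ⟨⟨(inv_anti₀ (by linarith) hR1).trans hr2, hr1.trans hR1⟩, fun j =>
    ⟨?_, ((hj₀ j).trans hWR).trans hR2⟩⟩
  rw [Pi.inv_apply]
  refine inv_anti₀ (hs.price_pos j) (le_trans ?_ hR3)
  have hpj : p j * (c j * n) ≤ n * R₁ := by
    calc p j * (c j * n) ≤ ∑ j, p j * (c j * n) :=
          Finset.single_le_sum (f := fun j => p j * (c j * n))
            (fun j _ => (mul_pos (hs.price_pos j) (mul_pos (hc j) hn')).le) (Finset.mem_univ j)
      _ = ∑ i, groupBudget z 1 r i := hs.revenue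
      _ ≤ ∑ _i : Fin n, R₁ := Finset.sum_le_sum fun i _ => by
          unfold groupBudget; split_ifs; exacts [hr1, hR₁1]
      _ = n * R₁ := by simp
  refine le_trans ?_ (Finset.single_le_sum (f := fun j => R₁ / c j)
    (fun j _ => (div_pos (by linarith) (hc j)).le) (Finset.mem_univ j))
  rw [le_div_iff₀ (hc j)]
  refine le_of_mul_le_mul_right ?_ hn'
  linarith

lemma groupBudget_le {n : ℕ} {z : Fin n → Fin 2} {g : Fin 2} {r R : ℝ} (hr : r ≤ R) (hR : 1 ≤ R)
    (k : Fin n) : groupBudget z g r k ≤ R := by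
  unfold groupBudget; split_ifs; exacts [hr, hR]

/-! ### Stability under a change of one report -/

/-- If one individual is replaced, then the utilities of all others change by a bounded amount
in total. -/
lemma exists_sum_abs_sub_le {J : Type*} [Fintype J] [Nonempty J] {c : J → ℝ}
    (hc : ∀ j, 0 < c j) {vbar a δ : ℝ} (hvbar : 0 < vbar) (ha : 0 < a) (hδ : 0 < δ) :
    ∃ C : ℝ, ∀ (n : ℕ) (z : Fin n → Fin 2) (v v' : Fin n → J → ℝ) (r r' : ℝ)
      (x x' : Fin n → J → ℝ) (p p' : J → ℝ) (i : Fin n),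
      IsEqualized c z v r x p → IsEqualized c z v' r' x' p' →
      IsSpread a δ z v → IsSpread a δ z v' → (∀ i j, 0 < v i j ∧ v i j ≤ vbar) →
      (∀ i j, 0 < v' i j ∧ v' i j ≤ vbar) → (∀ k, k ≠ i → v' k = v k) →
      ∑ k ∈ Finset.univ.erase i, |util (v k) (x k) - util (v' k) (x' k)| ≤ C := by
  classical
  obtain ⟨R, hR1, hR⟩ := exists_equalized_bounds hc hvbar ha hδ
  obtain ⟨j₀, hj₀⟩ := Finite.exists_min c
  have hR0 : 0 < R := by linarith
  set U : ℝ := R * (vbar * R) with hU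
  have hU0 : 0 < U := by positivity
  set μ : ℝ := R⁻¹ * c j₀ with hμ
  have hμ0 : 0 < μ := mul_pos (inv_pos.2 hR0) (hc j₀)
  set D : ℝ := R / μ with hD
  have hD0 : 0 < D := div_pos hR0 hμ0
  set E : ℝ := U + 2 * (D * U) with hE
  have hE0 : 0 < E := by positivity
  refine ⟨2 * (E / a + E), ?_⟩
  -- The two markets play symmetric roles, so `r ≤ r'` may be assumed.
  suffices key : ∀ (n : ℕ) (z : Fin n → Fin 2) (v v' : Fin n → J → ℝ) (r r' : ℝ)
      (x x' : Fin n → J → ℝ) (p p' : J → ℝ) (i : Fin n),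
      IsEqualized c z v r x p → IsEqualized c z v' r' x' p' →
      IsSpread a δ z v → IsSpread a δ z v' → (∀ i j, 0 < v i j ∧ v i j ≤ vbar) →
      (∀ i j, 0 < v' i j ∧ v' i j ≤ vbar) → (∀ k, k ≠ i → v' k = v k) → r ≤ r' →
      ∑ k ∈ Finset.univ.erase i, |util (v k) (x k) - util (v' k) (x' k)| ≤ 2 * (E / a + E) by
    intro n z v v' r r' x x' p p' i h h' hs hs' hv hv' hvv
    rcases le_total r r' with hr | hr
    · exact key n z v v' r r' x x' p p' i h h' hs hs' hv hv' hvv hr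
    · simp_rw [abs_sub_comm (util (v _) (x _))]
      exact key n z v' v r' r x' x p' p i h' h hs' hs hv' hv (fun k hk => (hvv k hk).symm) hr
  intro n z v v' r r' x x' p p' i h h' hs hs' hv hv' hvv hrr
  have hn : 0 < n := i.pos
  have hn' : (0 : ℝ) < n := Nat.cast_pos.2 hn
  obtain ⟨⟨-, hrR⟩, hp⟩ := hR n z v r x p hn h hs hv
  obtain ⟨⟨-, hrR'⟩, hp'⟩ := hR n z v' r' x' p' hn h' hs' hv'
  have hS := h.supporting
  have hS' := h'.supporting
  have hb := groupBudget_pos z 1 h.ratio_pos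
  have hb' := groupBudget_pos z 1 h'.ratio_pos
  have hr0 := h.ratio_pos
  set t : ℝ := r' / r with ht
  have ht1 : 1 ≤ t := (one_le_div hr0).2 hrr
  have ht0 : 0 < t := by linarith
  have htr : t * r = r' := div_mul_cancel₀ _ hr0.ne'
  have hRp : ∀ {q : J → ℝ}, (∀ j, 0 < q j) → (∀ j, R⁻¹ ≤ q⁻¹ j ∧ q⁻¹ j ≤ R) →
      ∀ j, μ * n ≤ q j * (c j * n) := by
    intro q hq hqR j
    have h1 : R⁻¹ ≤ q j := inv_le_of_inv_le₀ (hq j) (hqR j).2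
    have h2 : R⁻¹ * c j₀ ≤ q j * c j := mul_le_mul h1 (hj₀ j) (hc j₀).le (hq j).le
    calc μ * n ≤ q j * c j * n := mul_le_mul_of_nonneg_right h2 hn'.le
      _ = _ := by ring
  set e : ℝ := D / n with he
  have he0 : 0 < e := div_pos hD0 hn'
  have heD : e * n = D := div_mul_cancel₀ _ hn'.ne'
  have hbe : ∀ {B : ℝ}, B ≤ R → B / (μ * n) ≤ e := by
    intro B hB
    rw [he, hD, div_div]
    exact div_le_div_of_nonneg_right hB (by positivity)
  have hpp : ∀ j, p j ≤ (1 + e) * p' j := by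
    intro j
    refine (hS.price_le hS' i hb hvv (fun k _ => ?_) (by positivity)
      (hRp hS'.price_pos hp') j).trans ?_
    · unfold groupBudget; split_ifs; exacts [hrr, le_rfl]
    · have := hbe (groupBudget_le (z := z) (g := 1) hrR hR1 i)
      exact mul_le_mul_of_nonneg_right (by linarith) (hS'.price_pos j).le
  -- Scaling the first market by `t = r' / r` turns its budgets into `r'` and `t ≥ 1`. These
  -- dominate the budgets of the second market, so monotonicity applies in the reverse direction.
  have hpp' : ∀ j, p' j ≤ (1 + e) * (t * p j) := by
    intro j
    refine (hS'.price_le (hS.smul ht0) i hb' (fun k hk => (hvv k hk).symm) (fun k _ => ?_)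
      (m := μ * n) (by positivity) (fun j => ?_) j).trans ?_
    · unfold groupBudget; split_ifs; exacts [htr.ge, by linarith]
    · rw [mul_assoc]
      have h1 := hRp hS.price_pos hp j
      have h2 : 0 < μ * n := by positivity
      nlinarith
    · have := hbe (groupBudget_le (z := z) (g := 1) hrR' hR1 i)
      exact mul_le_mul_of_nonneg_right (by linarith) (mul_pos ht0 (hS.price_pos j)).le
  have hw : ∀ j, p'⁻¹ j ≤ (1 + e) * p⁻¹ j := fun j => by
    rw [Pi.inv_apply, Pi.inv_apply, ← div_eq_mul_inv, inv_eq_one_div,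
      div_le_div_iff₀ (hS'.price_pos j) (hS.price_pos j), one_mul]
    exact hpp j
  have hw' : ∀ j, p⁻¹ j ≤ ((1 + e) * t) * p'⁻¹ j := fun j => by
    rw [Pi.inv_apply, Pi.inv_apply, ← div_eq_mul_inv, inv_eq_one_div,
      div_le_div_iff₀ (hS.price_pos j) (hS'.price_pos j), one_mul, mul_assoc]
    exact hpp' j
  set u : Fin n → ℝ := fun k => util (v k) (x k) with hu
  set u' : Fin n → ℝ := fun k => util (v' k) (x' k) with hu'
  have hu0 : ∀ k, 0 < u k := hS.util_pos
  have hu0' : ∀ k, 0 < u' k := hS'.util_pos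
  have hbound : ∀ {B : ℝ} {q w : J → ℝ}, 0 < B → B ≤ R → (∀ j, 0 < q j) →
      (∀ j, R⁻¹ ≤ q⁻¹ j ∧ q⁻¹ j ≤ R) →
      (∀ j, 0 < w j ∧ w j ≤ vbar) → B * bestRate q⁻¹ w ≤ U := by
    intro B q w hB hBR hq hqR hw
    refine mul_le_mul hBR (bestRate_le fun j => ?_) (bestRate_pos
      (fun j => inv_pos.2 (hq j)) fun j => (hw j).1).le hR0.le
    exact mul_le_mul (hw j).2 (hqR j).2 (inv_pos.2 (hq j)).le hvbar.le
  have huU : ∀ k, u k ≤ U := fun k => by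
    rw [hu]; dsimp only; rw [hS.util_eq (hb k)]
    exact hbound (hb k) (groupBudget_le hrR hR1 k) hS.price_pos hp (hv k)
  have huU' : ∀ k, u' k ≤ U := fun k => by
    rw [hu']; dsimp only; rw [hS'.util_eq (hb' k)]
    exact hbound (hb' k) (groupBudget_le hrR' hR1 k) hS'.price_pos hp' (hv' k)
  have hg0 : ∀ k, k ≠ i → z k = 0 → u' k ≤ (1 + e) * u k := by
    intro k hk hz
    rw [hu, hu']; dsimp only
    rw [hS.util_eq (hb k), hS'.util_eq (hb' k), hvv k hk]
    simp only [groupBudget, hz, zero_ne_one, if_false, one_mul]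
    exact bestRate_le_mul (by linarith) (fun j => (hv k j).1.le) hw
  have hg1 : ∀ k, k ≠ i → z k = 1 → u k ≤ (1 + e) * u' k := by
    intro k hk hz
    rw [hu, hu']; dsimp only
    rw [hS.util_eq (hb k), hS'.util_eq (hb' k), hvv k hk]
    simp only [groupBudget, hz, if_true]
    have := bestRate_le_mul (t := (1 + e) * t) (by positivity) (fun j => (hv k j).1.le) hw'
    calc r * bestRate p⁻¹ (v k) ≤ r * ((1 + e) * t * bestRate p'⁻¹ (v k)) :=
          mul_le_mul_of_nonneg_left this hr0.le
      _ = (1 + e) * ((t * r) * bestRate p'⁻¹ (v k)) := by ring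
      _ = _ := by rw [htr]
  -- When utilities essentially move one way, the sum of absolute changes is the change of the sum
  -- up to a constant: `2 * (e * U)` per individual adds up to at most `2 * (D * U)`, and a further
  -- `U` covers individual `i`, who is still part of the averages.
  have hgen : ∀ (g : Fin 2) (y y' : Fin n → ℝ), (∀ k, 0 < y k) → (∀ k, y k ≤ U) →
      (∀ k, 0 < y' k) → (∀ k, y' k ≤ U) → (∀ k, k ≠ i → z k = g → y' k ≤ (1 + e) * y k) →
      ∑ k with z k = g, (if k = i then 0 else |y k - y' k|) ≤
        ∑ k with z k = g, y k - ∑ k with z k = g, y' k + E := by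
    intro g y y' hy hyU hy' hyU' hyy
    have hterm : ∀ k ∈ Finset.univ.filter (fun k => z k = g),
        (if k = i then 0 else |y k - y' k|) ≤
          y k - y' k + ((if k = i then U else 0) + 2 * (e * U)) := by
      intro k hk
      have heU : 0 < e * U := by positivity
      by_cases hki : k = i
      · simp only [hki, if_true]; linarith [hy i, hyU' i]
      · simp only [hki, if_false]
        have h1 := hyy k hki (Finset.mem_filter.1 hk).2
        have h2 : e * y k ≤ e * U := mul_le_mul_of_nonneg_left (hyU k) he0.le
        rcases abs_cases (y k - y' k) with ⟨h3, -⟩ | ⟨h3, -⟩ <;> rw [h3] <;> linarith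
    refine (Finset.sum_le_sum hterm).trans ?_
    rw [Finset.sum_add_distrib, Finset.sum_sub_distrib, Finset.sum_add_distrib, Finset.sum_const,
      nsmul_eq_mul]
    have h1 : ∑ k with z k = g, (if k = i then U else 0) ≤ U := by
      rw [Finset.sum_ite_eq']; split_ifs; exacts [le_rfl, hU0.le]
    have h2 : ((Finset.univ.filter fun k => z k = g).card : ℝ) * (2 * (e * U)) ≤
        2 * (D * U) := by
      calc _ ≤ (n : ℝ) * (2 * (e * U)) :=
            mul_le_mul_of_nonneg_right (card_group_le z g) (by positivity)
        _ = 2 * (e * n * U) := by ring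
        _ = _ := by rw [heD]
    linarith
  have hS0 := hgen 0 u u' hu0 huU hu0' huU' hg0
  have hS1 := hgen 1 u' u hu0' huU' hu0 huU hg1
  simp_rw [abs_sub_comm (u' _)] at hS1
  have hcard : ∀ g, 0 < ((Finset.univ.filter fun i => z i = g).card : ℝ) := fun g =>
    (mul_pos ha hn').trans_le (hs.le_card g)
  simp only [hu, hu', sum_group_eq _ _ (hcard _), h.avg_eq, h'.avg_eq] at hS0 hS1
  set A : ℝ := groupAvg z v x 0 - groupAvg z v' x' 0 with hA
  set N : Fin 2 → ℝ := fun g => ((Finset.univ.filter fun i => z i = g).card : ℝ) with hN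
  have hnn : ∀ g, 0 ≤ ∑ k with z k = g, (if k = i then 0 else |u k - u' k|) := fun g =>
    Finset.sum_nonneg fun k _ => by split_ifs; exacts [le_rfl, abs_nonneg _]
  -- The common change `A` of the averages enters the two classes with opposite signs. If `A > 0`,
  -- then `S₂ ≥ 0` forces `m₂ * A ≤ E`, and comparable class sizes carry this over to `m₁ * A ≤ E /
  -- a`.
  have hfin : ∀ (m₁ m₂ A S₁ S₂ : ℝ), a * n ≤ m₁ → m₁ ≤ n → a * n ≤ m₂ → 0 ≤ S₁ → 0 ≤ S₂ →
      S₁ ≤ m₁ * A + E → S₂ ≤ -(m₂ * A) + E → S₁ ≤ E / a + E := by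
    intro m₁ m₂ A S₁ S₂ h1 h2 h3 h4 h5 h6 h7
    have hm₁ : 0 < m₁ := (mul_pos ha hn').trans_le h1
    rcases le_or_gt A 0 with hA | hA
    · have : m₁ * A ≤ 0 := mul_nonpos_of_nonneg_of_nonpos hm₁.le hA
      have : 0 < E / a := div_pos hE0 ha
      linarith
    · have e1 : a * n * A ≤ m₂ * A := mul_le_mul_of_nonneg_right h3 hA.le
      have e2 : n * A ≤ E / a := by rw [le_div_iff₀ ha]; linarith
      have e3 : m₁ * A ≤ n * A := mul_le_mul_of_nonneg_right h2 hA.le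
      linarith
  have f0 := hfin (N 0) (N 1) A _ _ (hs.le_card 0) (card_group_le z 0) (hs.le_card 1) (hnn 0)
    (hnn 1) (by linarith) (by linarith)
  have f1 := hfin (N 1) (N 0) (-A) _ _ (hs.le_card 1) (card_group_le z 1) (hs.le_card 0) (hnn 1)
    (hnn 0) (by linarith) (by linarith)
  calc ∑ k ∈ Finset.univ.erase i, |u k - u' k|
      = ∑ k ∈ Finset.univ.erase i, (if k = i then 0 else |u k - u' k|) :=
        Finset.sum_congr rfl fun k hk => by rw [if_neg (Finset.mem_erase.1 hk).1]
    _ = ∑ k, (if k = i then 0 else |u k - u' k|) := Finset.sum_erase _ (by simp)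
    _ = ∑ g, ∑ k with z k = g, (if k = i then 0 else |u k - u' k|) :=
        (Finset.sum_fiberwise _ _ _).symm
    _ ≤ 2 * (E / a + E) := by rw [Fin.sum_univ_two]; linarith

/-! ### Valuations that detect a change of prices -/

lemma continuous_bestRate {J : Type*} [Fintype J] [Nonempty J] :
    Continuous fun q : (J → ℝ) × (J → ℝ) => bestRate q.1 q.2 :=
  Continuous.finset_sup'_apply _ fun j _ => by fun_prop

/-- Valuations concentrated on item `j` isolate `w j`. Since valuations are strictly positive, the
other entries can only tend to `0`, and the identity is obtained as a limit. -/
lemma mul_eq_mul_of_bestRate_eq {J : Type*} [Fintype J] [Nonempty J] {vbar : ℝ} (hvbar : 0 < vbar)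
    {w w' : J → ℝ} (hw : ∀ j, 0 < w j) (hw' : ∀ j, 0 < w' j) {r r' : ℝ}
    (h : ∀ v : Valuation J vbar, r * bestRate w v = r' * bestRate w' v) (j : J) :
    r * w j = r' * w' j := by
  classical
  set y : ℝ → J → ℝ := fun τ k => if k = j then vbar else τ with hy
  have hyc : Continuous y := continuous_pi fun k => by
    by_cases hk : k = j <;> simp only [hy, hk, if_true, if_false] <;> fun_prop
  have hlim : ∀ w : J → ℝ, (∀ j, 0 < w j) →
      Filter.Tendsto (fun τ => bestRate w (y τ)) (nhdsWithin 0 (Set.Ioi 0)) (nhds (vbar * w j)) := by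
    intro w hw
    have h0 : bestRate w (y 0) = vbar * w j := by
      refine le_antisymm (bestRate_le fun k => ?_) ?_
      · by_cases hk : k = j
        · simp [hy, hk]
        · simp only [hy, hk, if_false, zero_mul]
          exact (mul_pos hvbar (hw j)).le
      · simpa [hy] using le_bestRate w (y 0) j
    rw [← h0]
    have : Continuous fun τ => bestRate w (y τ) :=
      continuous_bestRate.comp (continuous_const.prodMk hyc)
    exact this.continuousAt.continuousWithinAt
  have hev : (fun τ => r * bestRate w (y τ)) =ᶠ[nhdsWithin 0 (Set.Ioi 0)]
      fun τ => r' * bestRate w' (y τ) := by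
    filter_upwards [Ioo_mem_nhdsGT hvbar] with τ hτ
    refine h ⟨y τ, fun k => ?_⟩
    by_cases hk : k = j <;> simp only [hy, hk, if_true, if_false]
    exacts [⟨hvbar, le_rfl⟩, ⟨hτ.1, hτ.2.le⟩]
  have := tendsto_nhds_unique ((hlim w hw).const_mul r)
    (((hlim w' hw').const_mul r').congr' hev.symm)
  refine mul_left_cancel₀ hvbar.ne' ?_
  linarith

lemma preconnectedSpace_valuation (J : Type*) (vbar : ℝ) : PreconnectedSpace (Valuation J vbar) := by
  have : {v : J → ℝ | ∀ j, 0 < v j ∧ v j ≤ vbar} = Set.pi Set.univ fun _ => Set.Ioc 0 vbar := by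
    ext v; simp
  refine Subtype.preconnectedSpace (Convex.isPreconnected ?_)
  change Convex ℝ {v : J → ℝ | ∀ j, 0 < v j ∧ v j ≤ vbar}
  rw [this]
  exact convex_pi fun _ _ => convex_Ioc _ _

/-- A valuation that tells apart two different price systems (and budget ratios) with the same
group sizes: neither group obtains the same utility under both. -/
lemma exists_bestRate_ne {J : Type*} [Fintype J] [Nonempty J] {vbar : ℝ} (hvbar : 0 < vbar)
    {c w w' : J → ℝ} (hw : ∀ j, 0 < w j) (hw' : ∀ j, 0 < w' j)
    {ν r r' : ℝ} (hν : 0 < ν) (hν' : ν < 1) (hr : 0 < r) (hr' : 0 < r')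
    (hrev : 1 - ν + ν * r = ∑ j, c j * (w j)⁻¹) (hrev' : 1 - ν + ν * r' = ∑ j, c j * (w' j)⁻¹)
    (hne : (r, w) ≠ (r', w')) :
    ∃ v : Valuation J vbar, bestRate w v ≠ bestRate w' v ∧
      r * bestRate w v ≠ r' * bestRate w' v := by
  by_contra! hcon
  have hcont : ∀ w : J → ℝ, Continuous fun v : Valuation J vbar => bestRate w v := fun w =>
    continuous_bestRate.comp (continuous_const.prodMk continuous_subtype_val)
  have hpre := preconnectedSpace_valuation J vbar
  -- The two closed sets of valuations on which class `0`, respectively class `1`, notices nothing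
  -- would cover a connected space. If both are nonempty they meet, which forces `r = r'` and makes
  -- them equal; so in every case one of them is everything.
  have hcl := isPreconnected_closed_iff.1 hpre.isPreconnected_univ
    {v | bestRate w v = bestRate w' v} {v | r * bestRate w v = r' * bestRate w' v}
    (isClosed_eq (hcont w) (hcont w'))
    (isClosed_eq ((hcont w).const_mul r) ((hcont w').const_mul r'))
    (fun v _ => or_iff_not_imp_left.2 fun h => hcon v h)
  have hcase : (∀ v : Valuation J vbar, 1 * bestRate w v = 1 * bestRate w' v) ∨
      ∀ v : Valuation J vbar, r * bestRate w v = r' * bestRate w' v := by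
    by_cases h1 : ∃ v : Valuation J vbar, bestRate w v = bestRate w' v
    · by_cases h2 : ∃ v : Valuation J vbar, r * bestRate w v = r' * bestRate w' v
      · obtain ⟨v₁, hv₁⟩ := h1
        obtain ⟨v₂, hv₂⟩ := h2
        obtain ⟨v, -, hv, hv2⟩ := hcl ⟨v₁, trivial, hv₁⟩ ⟨v₂, trivial, hv₂⟩
        have hpos := bestRate_pos hw' fun j => (v.2 j).1
        rw [Set.mem_ofPred_eq] at hv hv2
        rw [hv] at hv2
        have hrr : r = r' := mul_right_cancel₀ hpos.ne' hv2
        right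
        intro v
        by_cases h : bestRate w v = bestRate w' v
        · rw [h, hrr]
        · exact hcon v h
      · push Not at h2
        left
        intro v
        by_contra h
        exact h2 v (hcon v fun h' => h (by rw [h']))
    · push Not at h1
      exact Or.inr fun v => hcon v (h1 v)
  apply hne
  -- One class noticing nothing determines prices up to the factor in its budget. The revenue
  -- identity fixes the rest, using `ν > 0` in the first case and `ν < 1` in the second.
  rcases hcase with h | h
  · have hww : w = w' := funext fun j => by
      simpa using mul_eq_mul_of_bestRate_eq hvbar hw hw' h j
    subst hww
    rw [← hrev'] at hrev
    have : r = r' := mul_left_cancel₀ hν.ne' (by linarith)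
    rw [this]
  · have hww := mul_eq_mul_of_bestRate_eq hvbar hw hw' h
    have hsum : r' * ∑ j, c j * (w j)⁻¹ = r * ∑ j, c j * (w' j)⁻¹ := by
      rw [Finset.mul_sum, Finset.mul_sum]
      refine Finset.sum_congr rfl fun j _ => ?_
      have h1 := (hw j).ne'
      have h2 := (hw' j).ne'
      field_simp
      linear_combination (-c j) * hww j
    rw [← hrev, ← hrev'] at hsum
    have hrr : r = r' := mul_left_cancel₀ (sub_pos.2 hν').ne' (by linarith)
    subst hrr
    rw [funext fun j => mul_left_cancel₀ hr.ne' (hww j)]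

/-- Finitely many open sets of valuations suffice to tell apart all price systems that are not
close to each other. -/
lemma exists_test_family {J : Type*} [Fintype J] [Nonempty J] {vbar : ℝ} (hvbar : 0 < vbar)
    (c : J → ℝ) {a R η : ℝ} (ha : 0 < a) (hR : 0 < R) (hη : 0 < η) :
    ∃ (F : Finset (Set (Valuation J vbar))) (d : ℝ), 0 < d ∧ (∀ A ∈ F, IsOpen A ∧ A.Nonempty) ∧
      ∀ (ν r r' : ℝ) (w w' : J → ℝ), a ≤ ν → ν ≤ 1 - a → R⁻¹ ≤ r → r ≤ R → R⁻¹ ≤ r' → r' ≤ R →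
        (∀ j, R⁻¹ ≤ w j ∧ w j ≤ R) → (∀ j, R⁻¹ ≤ w' j ∧ w' j ≤ R) →
        1 - ν + ν * r = ∑ j, c j * (w j)⁻¹ → 1 - ν + ν * r' = ∑ j, c j * (w' j)⁻¹ →
        η ≤ dist (r, w) (r', w') →
        ∃ A ∈ F, ∀ v ∈ A, d ≤ |bestRate w v - bestRate w' v| ∧
          d ≤ |r * bestRate w v - r' * bestRate w' v| := by
  classical
  set L : Set (ℝ × (ℝ × (J → ℝ)) × (ℝ × (J → ℝ))) :=
    Set.Icc a (1 - a) ×ˢ ((Set.Icc R⁻¹ R ×ˢ Set.Icc (fun _ => R⁻¹) fun _ => R) ×ˢ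
      (Set.Icc R⁻¹ R ×ˢ Set.Icc (fun _ => R⁻¹) fun _ => R)) with hL
  have hLc : IsCompact L :=
    isCompact_Icc.prod ((isCompact_Icc.prod isCompact_Icc).prod (isCompact_Icc.prod isCompact_Icc))
  have hR' : 0 < R⁻¹ := inv_pos.2 hR
  set G : ℝ × (ℝ × (J → ℝ)) × (ℝ × (J → ℝ)) → ℝ × ℝ := fun θ =>
    (1 - θ.1 + θ.1 * θ.2.1.1 - ∑ j, c j * (θ.2.1.2 j)⁻¹,
      1 - θ.1 + θ.1 * θ.2.2.1 - ∑ j, c j * (θ.2.2.2 j)⁻¹) with hG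
  have hGc : ContinuousOn G L := by
    refine ContinuousOn.prodMk ?_ ?_
    · refine ContinuousOn.sub (by fun_prop) (continuousOn_finsetSum _ fun j _ => ?_)
      refine continuousOn_const.mul (ContinuousOn.inv₀ (by fun_prop) fun θ hθ => ?_)
      exact (hR'.trans_le (hθ.2.1.2.1 j)).ne'
    · refine ContinuousOn.sub (by fun_prop) (continuousOn_finsetSum _ fun j _ => ?_)
      refine continuousOn_const.mul (ContinuousOn.inv₀ (by fun_prop) fun θ hθ => ?_)
      exact (hR'.trans_le (hθ.2.2.2.1 j)).ne'
  -- Pairs of bounded parameters that satisfy the revenue identity and are at least `η` apart. Near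
  -- each of them one open set of valuations and one threshold work, and compactness leaves finitely
  -- many.
  set K := (L ∩ G ⁻¹' {0}) ∩ {θ | η ≤ dist θ.2.1 θ.2.2} with hK
  have hKc : IsCompact K := by
    refine IsCompact.inter_right ?_ (isClosed_le continuous_const (by fun_prop))
    exact hLc.of_isClosed_subset
      (hGc.preimage_isClosed_of_isClosed hLc.isClosed isClosed_singleton) Set.inter_subset_left
  set D : (ℝ × (ℝ × (J → ℝ)) × (ℝ × (J → ℝ))) × Valuation J vbar → ℝ := fun q =>
    min |bestRate q.1.2.1.2 q.2 - bestRate q.1.2.2.2 q.2|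
      |q.1.2.1.1 * bestRate q.1.2.1.2 q.2 - q.1.2.2.1 * bestRate q.1.2.2.2 q.2| with hD
  have hDc : Continuous D := by
    have h1 : Continuous fun q : (ℝ × (ℝ × (J → ℝ)) × (ℝ × (J → ℝ))) × Valuation J vbar =>
        bestRate q.1.2.1.2 q.2 :=
      continuous_bestRate.comp (Continuous.prodMk (by fun_prop) (by fun_prop))
    have h2 : Continuous fun q : (ℝ × (ℝ × (J → ℝ)) × (ℝ × (J → ℝ))) × Valuation J vbar =>
        bestRate q.1.2.2.2 q.2 :=
      continuous_bestRate.comp (Continuous.prodMk (by fun_prop) (by fun_prop))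
    exact (h1.sub h2).abs.min
      (((by fun_prop : Continuous _).mul h1).sub ((by fun_prop : Continuous _).mul h2)).abs
  have main : ∃ (F : Finset (Set (Valuation J vbar))) (d : ℝ), 0 < d ∧
      (∀ A ∈ F, IsOpen A ∧ A.Nonempty) ∧ ∀ θ ∈ K, ∃ A ∈ F, ∀ v ∈ A, d ≤ D (θ, v) := by
    refine hKc.induction_on (p := fun S => ∃ (F : Finset (Set (Valuation J vbar))) (d : ℝ), 0 < d ∧
      (∀ A ∈ F, IsOpen A ∧ A.Nonempty) ∧ ∀ θ ∈ S, ∃ A ∈ F, ∀ v ∈ A, d ≤ D (θ, v)) ?_ ?_ ?_ ?_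
    · exact ⟨∅, 1, one_pos, by simp, by simp⟩
    · rintro S T hST ⟨F, d, hd, hF, h⟩
      exact ⟨F, d, hd, hF, fun θ hθ => h θ (hST hθ)⟩
    · rintro S T ⟨F, d, hd, hF, h⟩ ⟨F', d', hd', hF', h'⟩
      refine ⟨F ∪ F', min d d', lt_min hd hd', fun A hA => ?_, ?_⟩
      · rcases Finset.mem_union.1 hA with hA | hA
        exacts [hF A hA, hF' A hA]
      · rintro θ (hθ | hθ)
        · obtain ⟨A, hA, hv⟩ := h θ hθ
          exact ⟨A, Finset.mem_union_left _ hA, fun v hvA => (min_le_left _ _).trans (hv v hvA)⟩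
        · obtain ⟨A, hA, hv⟩ := h' θ hθ
          exact ⟨A, Finset.mem_union_right _ hA, fun v hvA => (min_le_right _ _).trans (hv v hvA)⟩
    · rintro θ ⟨⟨hθL, hθG⟩, hθη⟩
      have hG0 : G θ = 0 := hθG
      simp only [hG, Prod.mk_eq_zero] at hG0
      obtain ⟨v, hv1, hv2⟩ := exists_bestRate_ne (c := c) hvbar
        (fun j => hR'.trans_le (hθL.2.1.2.1 j)) (fun j => hR'.trans_le (hθL.2.2.2.1 j))
        (ha.trans_le hθL.1.1) (by linarith [hθL.1.2]) (hR'.trans_le hθL.2.1.1.1)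
        (hR'.trans_le hθL.2.2.1.1) (sub_eq_zero.1 hG0.1) (sub_eq_zero.1 hG0.2)
        (fun h => by
          have h' : θ.2.1 = θ.2.2 := h
          rw [Set.mem_ofPred_eq, h', dist_self] at hθη
          linarith)
      have hpos : 0 < D (θ, v) := lt_min (abs_pos.2 (sub_ne_zero.2 hv1))
        (abs_pos.2 (sub_ne_zero.2 hv2))
      have hnhds : {q | D (θ, v) / 2 < D q} ∈ nhds (θ, v) :=
        (isOpen_lt continuous_const hDc).mem_nhds (half_lt_self hpos)
      obtain ⟨T, A, hT, hθT, hA, hvA, hTA⟩ := mem_nhds_prod_iff'.1 hnhds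
      refine ⟨T, mem_nhdsWithin_of_mem_nhds (hT.mem_nhds hθT), {A}, _, half_pos hpos, ?_, ?_⟩
      · simpa using ⟨hA, ⟨v, hvA⟩⟩
      · exact fun θ' hθ' => ⟨A, Finset.mem_singleton_self A, fun v' hv' =>
          (hTA (Set.mk_mem_prod hθ' hv')).le⟩
  obtain ⟨F, d, hd, hF, h⟩ := main
  refine ⟨F, d, hd, hF, fun ν r r' w w' h1 h2 h3 h4 h5 h6 hw hw' e1 e2 hη' => ?_⟩
  obtain ⟨A, hA, hv⟩ := h (ν, (r, w), (r', w')) ⟨⟨⟨⟨h1, h2⟩, ⟨⟨h3, h4⟩, fun j => (hw j).1,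
    fun j => (hw j).2⟩, ⟨h5, h6⟩, fun j => (hw' j).1, fun j => (hw' j).2⟩,
    Prod.ext (sub_eq_zero.2 e1) (sub_eq_zero.2 e2)⟩, hη'⟩
  exact ⟨A, hA, fun v hvA => le_min_iff.1 (hv v hvA)⟩

/-! ### Small gains from misreports in rich samples -/

/-- Dividing budgets and prices by `B` when the favoured class is `0` puts both cases in one
normalization, with `r` above or below `1`. Outcomes that favour different classes become
comparable. -/
lemma IsCEEqI.exists_isEqualized {J : Type*} [Fintype J] {n : ℕ} {c : J → ℝ} {z : Fin n → Fin 2}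
    {v : Fin n → J → ℝ} {g : Fin 2} {B : ℝ} {x : Fin n → J → ℝ}
    (h : IsCEEqI (fun j => c j * n) z v g B x) (hc : ∀ j, 0 < c j) (hz : Function.Surjective z)
    (hv : ∀ i j, 0 < v i j) : ∃ r p, IsEqualized c z v r x p := by
  have hB : 0 < B := zero_lt_one.trans_le h.1
  have hn : NeZero n := ⟨by rintro rfl; obtain ⟨i, -⟩ := hz 0; exact i.elim0⟩
  have hn' : (0 : ℝ) < n := Nat.cast_pos.2 (NeZero.pos n)
  obtain ⟨p, hp⟩ := h.2.1.exists_isSupporting (fun j => mul_pos (hc j) hn')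
    (groupBudget_pos z g hB) hv
  rcases Fin.exists_fin_two.1 ⟨g, rfl⟩ with hg | hg
  · refine ⟨B⁻¹, fun j => B⁻¹ * p j, ⟨?_, inv_pos.2 hB, h.2.2 hz⟩⟩
    have : groupBudget z 1 B⁻¹ = fun i => B⁻¹ * groupBudget z g B i := by
      funext i
      rcases Fin.exists_fin_two.1 ⟨z i, rfl⟩ with hi | hi <;>
        simp [groupBudget, hi, hg, hB.ne']
    rw [this]
    exact hp.smul (inv_pos.2 hB)
  · exact ⟨B, p, by rwa [hg] at hp, hB, h.2.2 hz⟩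

lemma IsEqualized.revenue {J : Type*} [Fintype J] {n : ℕ} {c : J → ℝ} {z : Fin n → Fin 2}
    {v : Fin n → J → ℝ} {r : ℝ} {x : Fin n → J → ℝ} {p : J → ℝ} (h : IsEqualized c z v r x p)
    (hn : 0 < n) :
    1 - ((Finset.univ.filter fun i => z i = 1).card : ℝ) / n +
      ((Finset.univ.filter fun i => z i = 1).card : ℝ) / n * r = ∑ j, c j * (p⁻¹ j)⁻¹ := by
  have hn' : (n : ℝ) ≠ 0 := Nat.cast_ne_zero.2 hn.ne'
  have h1 := h.supporting.revenue
  have h2 : ∀ i, groupBudget z 1 r i = 1 + if z i = 1 then r - 1 else 0 := fun i => by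
    unfold groupBudget; split_ifs <;> ring
  simp only [h2, Finset.sum_add_distrib, Finset.sum_const, Finset.card_univ, Fintype.card_fin,
    nsmul_eq_mul, mul_one, ← Finset.sum_filter] at h1
  have h3 : ∑ j, c j * (p⁻¹ j)⁻¹ = (∑ j, p j * (c j * n)) / n := by
    rw [Finset.sum_div]
    exact Finset.sum_congr rfl fun j _ => by rw [Pi.inv_apply, inv_inv]; field_simp
  rw [h3, h1]
  field_simp
  ring

/-- The individuals other than `i` whose entry lies in `A`. -/
def othersIn {X : Type*} {n : ℕ} (ω : Fin n → X) (i : Fin n) (A : Set X) : Finset (Fin n) :=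
  open Classical in Finset.univ.filter fun k => k ≠ i ∧ ω k ∈ A

lemma mem_othersIn {X : Type*} {n : ℕ} {ω : Fin n → X} {i k : Fin n} {A : Set X} :
    k ∈ othersIn ω i A ↔ k ≠ i ∧ ω k ∈ A := by
  simp [othersIn]

/-- If the valuations of the others are rich enough, then nobody gains much by a misreport. -/
lemma exists_forall_util_le_add {J : Type*} [Fintype J] [Nonempty J] {c : J → ℝ}
    (hc : ∀ j, 0 < c j) {vbar a δ ε : ℝ} (hvbar : 0 < vbar) (ha : 0 < a) (hδ : 0 < δ)
    (hε : 0 < ε) :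
    ∃ F : Finset (Set (Valuation J vbar)), (∀ A ∈ F, IsOpen A ∧ A.Nonempty) ∧
      ∀ a₂ : ℝ, 0 < a₂ → ∃ N : ℕ, ∀ n : ℕ, N < n → ∀ (z : Fin n → Fin 2)
        (v v' : Fin n → Valuation J vbar) (r r' : ℝ) (x x' : Fin n → J → ℝ) (p p' : J → ℝ)
        (i : Fin n), IsEqualized c z (fun k => (v k : J → ℝ)) r x p →
        IsEqualized c z (fun k => (v' k : J → ℝ)) r' x' p' →
        IsSpread a δ z (fun k => (v k : J → ℝ)) → IsSpread a δ z (fun k => (v' k : J → ℝ)) →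
        (∀ k, k ≠ i → v' k = v k) → (∀ A ∈ F, a₂ * n ≤ (othersIn v i A).card) →
        util (v i : J → ℝ) (x' i) ≤ util (v i : J → ℝ) (x i) + ε := by
  obtain ⟨R, hR1, hR⟩ := exists_equalized_bounds hc hvbar ha hδ
  obtain ⟨C, hC⟩ := exists_sum_abs_sub_le hc hvbar ha hδ
  have hR0 : 0 < R := by linarith
  -- Moving the budget by `η` and the inverse prices by `η` each changes the attainable utility by
  -- at most `R * vbar * η = ε / 2`.
  set η : ℝ := ε / (2 * (R * vbar)) with hη
  have hη0 : 0 < η := by positivity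
  obtain ⟨F, d, hd, hF, hFd⟩ := exists_test_family hvbar c ha hR0 hη0
  refine ⟨F, hF, fun a₂ ha₂ => ?_⟩
  obtain ⟨N, hN⟩ := exists_nat_gt (C / (a₂ * d))
  refine ⟨N, fun n hn z v v' r r' x x' p p' i h h' hs hs' hvv hcount => ?_⟩
  have hn0 : 0 < n := i.pos
  have hn' : (0 : ℝ) < n := Nat.cast_pos.2 hn0
  have hv : ∀ k j, 0 < (v k : J → ℝ) j ∧ (v k : J → ℝ) j ≤ vbar := fun k => (v k).2
  have hv' : ∀ k j, 0 < (v' k : J → ℝ) j ∧ (v' k : J → ℝ) j ≤ vbar := fun k => (v' k).2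
  obtain ⟨⟨hr1, hr2⟩, hw⟩ := hR n z _ r x p hn0 h hs hv
  obtain ⟨⟨hr1', hr2'⟩, hw'⟩ := hR n z _ r' x' p' hn0 h' hs' hv'
  have hsum := hC n z _ _ r r' x x' p p' i h h' hs hs' hv hv'
    (fun k hk => by rw [hvv k hk])
  have hS := h.supporting
  have hS' := h'.supporting
  have hb := groupBudget_pos z 1 h.ratio_pos
  have hb' := groupBudget_pos z 1 h'.ratio_pos
  have hcards : ((Finset.univ.filter fun i => z i = 0).card : ℝ) +
      (Finset.univ.filter fun i => z i = 1).card = n := by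
    have : ∑ g, (Finset.univ.filter fun i => z i = g).card = n := by
      rw [← Finset.card_eq_sum_card_fiberwise (fun _ _ => Finset.mem_coe.2 (Finset.mem_univ _)),
        Finset.card_univ, Fintype.card_fin]
    rw [Fin.sum_univ_two] at this
    exact_mod_cast this
  -- Otherwise at least `a₂ * n` others change utility by at least `d` each, which exceeds the
  -- constant `C` once `n > N`.
  have hdist : dist (r, p⁻¹) (r', p'⁻¹) < η := by
    by_contra! hge
    obtain ⟨A, hA, hAd⟩ := hFd _ r r' p⁻¹ p'⁻¹ ((le_div_iff₀ hn').2 (hs.le_card 1))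
      ((div_le_iff₀ hn').2 (by linarith [hs.le_card 0])) hr1 hr2 hr1' hr2' hw hw'
      (h.revenue hn0) (h'.revenue hn0) hge
    have hbig : a₂ * n * d ≤ C := calc
      a₂ * n * d ≤ (othersIn v i A).card * d :=
          mul_le_mul_of_nonneg_right (hcount A hA) hd.le
      _ = ∑ k ∈ othersIn v i A, d := by rw [Finset.sum_const, nsmul_eq_mul]
      _ ≤ ∑ k ∈ othersIn v i A, |util (v k : J → ℝ) (x k) - util (v' k : J → ℝ) (x' k)| := by
          refine Finset.sum_le_sum fun k hk => ?_
          obtain ⟨hki, hkA⟩ := mem_othersIn.1 hk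
          rw [hS.util_eq (hb k), hS'.util_eq (hb' k), hvv k hki]
          unfold groupBudget
          split_ifs
          · exact (hAd _ hkA).2
          · simpa using (hAd _ hkA).1
      _ ≤ _ := Finset.sum_le_sum_of_subset_of_nonneg
          (fun k hk => Finset.mem_erase.2 ⟨(mem_othersIn.1 hk).1, Finset.mem_univ k⟩)
          fun _ _ _ => abs_nonneg _
      _ ≤ C := hsum
    have : C < N * (a₂ * d) := (div_lt_iff₀ (by positivity)).1 hN
    have : (N : ℝ) * (a₂ * d) ≤ n * (a₂ * d) :=
      mul_le_mul_of_nonneg_right (Nat.cast_le.2 hn.le) (by positivity)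
    linarith
  rw [Prod.dist_eq, max_lt_iff, Real.dist_eq] at hdist
  have hwη : ∀ j, p'⁻¹ j ≤ p⁻¹ j + η := fun j => by
    have := (dist_le_pi_dist p⁻¹ p'⁻¹ j).trans hdist.2.le
    rw [Real.dist_eq] at this
    linarith [(abs_le.1 this).1]
  have hbη : groupBudget z 1 r' i ≤ groupBudget z 1 r i + η := by
    unfold groupBudget
    split_ifs
    · linarith [(abs_le.1 hdist.1.le).1]
    · linarith
  have hf0 : 0 < bestRate p⁻¹ (v i) :=
    bestRate_pos (fun j => inv_pos.2 (hS.price_pos j)) fun j => (hv i j).1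
  have hfR : bestRate p⁻¹ (v i) ≤ vbar * R := bestRate_le fun j =>
    mul_le_mul (hv i j).2 (hw j).2 (inv_pos.2 (hS.price_pos j)).le hvbar.le
  have hff : bestRate p'⁻¹ (v i) ≤ bestRate p⁻¹ (v i) + vbar * η := bestRate_le fun j => by
    have h1 := mul_le_mul_of_nonneg_left (hwη j) (hv i j).1.le
    have h2 := le_bestRate p⁻¹ (v i) j
    have h3 := mul_le_mul_of_nonneg_right (hv i j).2 hη0.le
    linarith
  -- The bundle obtained by misreporting is affordable at the new prices, so its true utility is at
  -- most what an optimal purchase there would give.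
  have hup := util_le_bestRate_mul_cost (v := (v i : J → ℝ)) hS'.price_pos (hS'.alloc_nonneg i)
  rw [hS'.cost_eq] at hup
  have heq : η * (2 * (R * vbar)) = ε := div_mul_cancel₀ _ (by positivity)
  rw [hS.util_eq (hb i)]
  calc util (v i : J → ℝ) (x' i) ≤ bestRate p'⁻¹ (v i) * groupBudget z 1 r' i := hup
    _ ≤ (bestRate p⁻¹ (v i) + vbar * η) * groupBudget z 1 r' i :=
        mul_le_mul_of_nonneg_right hff (hb' i).le
    _ = bestRate p⁻¹ (v i) * groupBudget z 1 r' i + vbar * η * groupBudget z 1 r' i := by ring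
    _ ≤ bestRate p⁻¹ (v i) * (groupBudget z 1 r i + η) + vbar * η * R :=
        add_le_add (mul_le_mul_of_nonneg_left hbη hf0.le)
          (mul_le_mul_of_nonneg_left (groupBudget_le hr2' hR1 i) (by positivity))
    _ = groupBudget z 1 r i * bestRate p⁻¹ (v i) + bestRate p⁻¹ (v i) * η + vbar * η * R := by
        ring
    _ ≤ groupBudget z 1 r i * bestRate p⁻¹ (v i) + vbar * R * η + vbar * η * R := by
        linarith [mul_le_mul_of_nonneg_right hfR hη0.le]
    _ = _ := by rw [← heq]; ring

/-! ### Rich samples are typical -/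

lemma exists_pos_le_forall {α : Type*} (F : Finset α) (f : α → ℝ) (hf : ∀ A ∈ F, 0 < f A) :
    ∃ q : ℝ, 0 < q ∧ q ≤ 1 ∧ ∀ A ∈ F, q ≤ f A := by
  classical
  induction F using Finset.induction_on with
  | empty => exact ⟨1, one_pos, le_rfl, by simp⟩
  | insert B F _ ih =>
    obtain ⟨q, hq, hq1, hqF⟩ := ih fun A hA => hf A (Finset.mem_insert_of_mem hA)
    refine ⟨min q (f B), lt_min hq (hf B (Finset.mem_insert_self B F)),
      (min_le_left _ _).trans hq1, fun A hA => ?_⟩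
    rcases Finset.mem_insert.1 hA with rfl | hA
    exacts [min_le_right _ _, (min_le_left _ _).trans (hqF A hA)]

/-- Chernoff bound: in an i.i.d. sample, an event of probability at least `q` rarely occurs for
less than a small fraction of the sample. The rare event is bounded by a function `h`. -/
lemma exists_rare_bound {X : Type*} [MeasurableSpace X] {q : ℝ} (hq : 0 < q) (hq1 : q ≤ 1) :
    ∃ a ρ : ℝ, 0 < a ∧ 0 ≤ ρ ∧ ρ < 1 ∧ ∀ (Q : Measure X) [IsProbabilityMeasure Q] (A : Set X),
      MeasurableSet A → q ≤ Q.real A → ∀ (n : ℕ) (i : Fin n), ∃ h : (Fin n → X) → ℝ,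
        Integrable h (Measure.pi fun _ => Q) ∧ ∫ ω, h ω ∂(Measure.pi fun _ => Q) ≤ 2 * ρ ^ n ∧
        (∀ ω, 0 ≤ h ω) ∧ ∀ ω, ((othersIn ω i A).card : ℝ) < a * n → 1 ≤ h ω := by
  classical
  -- Each factor `g` has mean at most `1 - q / 2`. Any `y > 1` with `y * (1 - q / 2) < 1` serves,
  -- and then `a = logb 2 y` makes `2 ^ (a * n) = y ^ n`.
  set y : ℝ := (1 - q / 4)⁻¹ with hy
  have hy1 : 1 < y := (one_lt_inv₀ (by linarith)).2 (by linarith)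
  have hy0 : 0 < y := by linarith
  refine ⟨Real.logb 2 y, y * (1 - q / 2), Real.logb_pos one_lt_two hy1,
    mul_nonneg hy0.le (by linarith), ?_, fun Q _ A hA hqA n i => ?_⟩
  · rw [hy, inv_mul_lt_iff₀ (by linarith)]; linarith
  set g : X → ℝ := fun t => if t ∈ A then 1 / 2 else 1 with hg
  have hgA : g = fun t => 1 - A.indicator (fun _ => (1 / 2 : ℝ)) t := by
    funext t; by_cases ht : t ∈ A <;> simp [hg, ht]; norm_num
  have hgi : Integrable g Q := by
    rw [hgA]
    exact (integrable_const _).sub ((integrable_const _).indicator hA)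
  have hgint : ∫ t, g t ∂Q = 1 - Q.real A / 2 := by
    rw [hgA, integral_sub (integrable_const _) ((integrable_const _).indicator hA),
      integral_indicator_const _ hA]
    simp [div_eq_mul_inv]
  have hg0 : ∀ t, 0 ≤ g t := fun t => by simp only [hg]; split_ifs <;> norm_num
  refine ⟨fun ω => 2 * y ^ n * ∏ k, g (ω k), ?_, ?_, fun ω => ?_, fun ω hω => ?_⟩
  · exact (Integrable.fintype_prod fun _ => hgi).const_mul _
  · rw [integral_const_mul, integral_fintype_prod_eq_pow, Fintype.card_fin, hgint, mul_pow,
      ← mul_assoc]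
    refine mul_le_mul_of_nonneg_left (pow_le_pow_left₀ ?_ (by linarith) n) (by positivity)
    have : Q.real A ≤ 1 := measureReal_le_one
    linarith
  · exact mul_nonneg (by positivity) (Finset.prod_nonneg fun k _ => hg0 _)
  · have hprod : ∏ k, g (ω k) = (1 / 2) ^ (Finset.univ.filter fun k => ω k ∈ A).card := by
      simp [hg, Finset.prod_ite]
    -- The product also runs over the coordinate `i`, which may lie in `A`; the factor `2` in front
    -- of the bound pays for it.
    have hcard : (Finset.univ.filter fun k => ω k ∈ A).card ≤ (othersIn ω i A).card + 1 := by
      refine (Finset.card_le_card (t := insert i (othersIn ω i A)) fun k hk => ?_).trans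
        (Finset.card_insert_le _ _)
      by_cases hki : k = i
      · simp [hki]
      · exact Finset.mem_insert_of_mem (mem_othersIn.2 ⟨hki, (Finset.mem_filter.1 hk).2⟩)
    set m := (othersIn ω i A).card with hm
    have hyn : (2 : ℝ) ^ m ≤ y ^ n := by
      rw [← Real.rpow_natCast, ← Real.rpow_natCast y]
      calc (2 : ℝ) ^ (m : ℝ) ≤ 2 ^ (Real.logb 2 y * n) :=
            Real.rpow_le_rpow_of_exponent_le one_le_two hω.le
        _ = y ^ (n : ℝ) := by
            rw [Real.rpow_mul zero_le_two, Real.rpow_logb zero_lt_two (by norm_num) hy0]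
    have hpow : ((1 : ℝ) / 2) ^ (m + 1) ≤ ∏ k, g (ω k) := by
      rw [hprod]
      exact pow_le_pow_of_le_one (by norm_num) (by norm_num) hcard
    calc (1 : ℝ) = 2 * 2 ^ m * (1 / 2) ^ (m + 1) := by
          rw [pow_succ, one_div, inv_pow]; field_simp
      _ ≤ 2 * y ^ n * (1 / 2) ^ (m + 1) :=
          mul_le_mul_of_nonneg_right (by linarith) (by positivity)
      _ ≤ _ := mul_le_mul_of_nonneg_left hpow (by positivity)

lemma isProbabilityMeasure_reportLaw {J : Type*} {vbar : ℝ}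
    (P : Measure (Fin 2 × Valuation J vbar)) [IsProbabilityMeasure P]
    (σ : Kernel (Fin 2 × Valuation J vbar) (Valuation J vbar)) [IsMarkovKernel σ] :
    IsProbabilityMeasure (reportLaw P σ) :=
  Measure.isProbabilityMeasure_map (by fun_prop)

lemma reportLaw_group {J : Type*} {vbar : ℝ}
    (P : Measure (Fin 2 × Valuation J vbar)) [IsProbabilityMeasure P]
    (σ : Kernel (Fin 2 × Valuation J vbar) (Valuation J vbar)) [IsMarkovKernel σ] (g : Fin 2) :
    reportLaw P σ {t | t.1 = g} = P {t | t.1 = g} := by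
  have hm : MeasurableSet {t : Fin 2 × Valuation J vbar | t.1 = g} :=
    measurable_fst (measurableSet_singleton g)
  rw [reportLaw, Measure.map_apply (by fun_prop) hm]
  conv_rhs => rw [← Measure.fst_compProd P σ, Measure.fst_apply hm]
  rfl

/-- Valuations are strictly positive, so each class is the countable union of its parts with all
values at least `1 / (m + 1)`, and one part has positive measure. -/
lemma exists_delta {J : Type*} [Fintype J] [Nonempty J] {vbar : ℝ}
    {Q : Measure (Fin 2 × Valuation J vbar)} (h : ∀ g : Fin 2, 0 < Q {t | t.1 = g}) :
    ∃ δ : ℝ, 0 < δ ∧ ∀ g : Fin 2, 0 < Q {t | t.1 = g ∧ ∀ j, δ ≤ (t.2 : J → ℝ) j} := by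
  have key : ∀ g : Fin 2, ∃ δ : ℝ, 0 < δ ∧ 0 < Q {t | t.1 = g ∧ ∀ j, δ ≤ (t.2 : J → ℝ) j} := by
    intro g
    by_contra! hcon
    refine (h g).ne' (measure_mono_null (fun t ht => ?_) (measure_iUnion_null
      fun m : ℕ => le_antisymm (hcon (1 / ((m : ℝ) + 1)) (by positivity)) bot_le))
    obtain ⟨j₀, hj₀⟩ := Finite.exists_min (t.2 : J → ℝ)
    obtain ⟨m, hm⟩ := exists_nat_one_div_lt (t.2.2 j₀).1
    exact Set.mem_iUnion.2 ⟨m, ht, fun j => hm.le.trans (hj₀ j)⟩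
  choose δ hδ hQ using key
  refine ⟨min (δ 0) (δ 1), lt_min (hδ 0) (hδ 1), fun g => (hQ g).trans_le (measure_mono ?_)⟩
  rintro t ⟨ht, hj⟩
  refine ⟨ht, fun j => le_trans ?_ (hj j)⟩
  rcases Fin.exists_fin_two.1 ⟨g, rfl⟩ with hg | hg <;> rw [hg]
  exacts [min_le_left _ _, min_le_right _ _]

lemma measurable_util {J Ω : Type*} [Fintype J] [MeasurableSpace Ω] (v : J → ℝ) {y : Ω → J → ℝ}
    (hy : Measurable y) : Measurable fun ω => util v (y ω) :=
  Finset.measurable_sum _ fun j _ => (measurable_pi_iff.1 hy j).const_mul (v j)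

lemma IsFeasible.util_le {J : Type*} [Fintype J] {n : ℕ} {c : J → ℝ} {vbar : ℝ}
    {x : Fin n → J → ℝ} (h : IsFeasible (fun j => c j * n) x) (hvbar : 0 ≤ vbar) {v : J → ℝ}
    (hv : ∀ j, v j ≤ vbar) (i : Fin n) : util v (x i) ≤ vbar * (∑ j, c j) * n := by
  rw [util, mul_assoc, Finset.sum_mul, Finset.mul_sum]
  refine Finset.sum_le_sum fun j _ => mul_le_mul (hv j) ?_ (h.1 i j) hvbar
  exact (Finset.single_le_sum (f := fun i => x i j) (fun k _ => h.1 k j)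
    (Finset.mem_univ i)).trans (h.2 j)

/-! ### Strategy-proofness in the large -/

theorem IsCEEqIMechanism.isSPL {J : Type*} [Fintype J] [Nonempty J] {vbar : ℝ} {c : J → ℝ}
    {P : Measure (Fin 2 × Valuation J vbar)} {M : Mechanism J vbar} (hc : ∀ j, 0 < c j)
    [IsProbabilityMeasure P] (hP : ∀ g : Fin 2, 0 < P {t | t.1 = g})
    (hM : IsCEEqIMechanism c M) : IsSPL P M := by
  intro σ hσ hopen ε hε
  have hprob := isProbabilityMeasure_reportLaw P σ
  set Q := reportLaw P σ with hQ
  have hvbar : 0 < vbar := by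
    obtain ⟨t⟩ : Nonempty (Fin 2 × Valuation J vbar) := P.nonempty_of_neZero
    have := t.2.2 (Classical.arbitrary J)
    linarith
  obtain ⟨δ, hδ, hQδ⟩ := exists_delta (Q := Q) fun g => by rw [hQ, reportLaw_group]; exact hP g
  set G : Fin 2 → Set (Fin 2 × Valuation J vbar) := fun g =>
    {t | t.1 = g ∧ ∀ j, δ ≤ (t.2 : J → ℝ) j} with hG
  have hGm : ∀ g, MeasurableSet (G g) := fun g => by
    refine (measurable_fst (measurableSet_singleton g)).inter ?_
    change MeasurableSet {t : Fin 2 × Valuation J vbar | ∀ j, δ ≤ (t.2 : J → ℝ) j}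
    rw [Set.ofPred_forall]
    exact MeasurableSet.iInter fun j => measurableSet_le measurable_const
      ((measurable_pi_apply j).comp (measurable_subtype_coe.comp measurable_snd))
  obtain ⟨q₁, hq₁, hq₁1, hq₁G⟩ := exists_pos_le_forall Finset.univ (fun g => Q.real (G g))
    fun g _ => ENNReal.toReal_pos (hQδ g).ne' (measure_ne_top Q _)
  obtain ⟨a, ρ, ha, hρ0, hρ1, hrare⟩ :=
    exists_rare_bound (X := Fin 2 × Valuation J vbar) hq₁ hq₁1
  obtain ⟨F, hF, hstable⟩ := exists_forall_util_le_add hc hvbar ha hδ (half_pos hε)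
  set S : Set (Valuation J vbar) → Set (Fin 2 × Valuation J vbar) := fun A => Prod.snd ⁻¹' A
    with hS
  have hSm : ∀ A ∈ F, MeasurableSet (S A) := fun A hA => measurable_snd (hF A hA).1.measurableSet
  obtain ⟨q₂, hq₂, hq₂1, hq₂F⟩ := exists_pos_le_forall F (fun A => Q.real (S A)) fun A hA => by
    refine ENNReal.toReal_pos ?_ (measure_ne_top Q _)
    rw [hS, ← Measure.map_apply measurable_snd (hF A hA).1.measurableSet]
    exact hopen.open_pos A (hF A hA).1 (hF A hA).2
  obtain ⟨a₂, ρ₂, ha₂, hρ₂0, hρ₂1, hrare₂⟩ :=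
    exists_rare_bound (X := Fin 2 × Valuation J vbar) hq₂ hq₂1
  obtain ⟨N₁, hN₁⟩ := hstable a₂ ha₂
  set K : ℝ := vbar * ∑ j, c j with hK
  have hK0 : 0 ≤ K := mul_nonneg hvbar.le (Finset.sum_nonneg fun j _ => (hc j).le)
  have hlim : Filter.Tendsto (fun n : ℕ => K * (4 * (n * ρ ^ n) + F.card * (2 * (n * ρ₂ ^ n))))
      Filter.atTop (nhds 0) := by
    have h1 := (tendsto_self_mul_const_pow_of_lt_one hρ0 hρ1).const_mul 4
    have h2 := ((tendsto_self_mul_const_pow_of_lt_one hρ₂0 hρ₂1).const_mul 2).const_mul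
      (F.card : ℝ)
    simpa using (h1.add h2).const_mul K
  obtain ⟨N₂, hN₂⟩ := Filter.eventually_atTop.1 (hlim.eventually_lt_const (half_pos hε))
  refine ⟨max N₁ N₂, fun n hn i z v v' => ?_⟩
  have hn1 : N₁ < n := (le_max_left _ _).trans_lt hn
  have hn2 : N₂ ≤ n := ((le_max_right _ _).trans_lt hn).le
  choose h₁ hint₁ hle₁ hnn₁ hbad₁ using fun g => hrare Q (G g) (hGm g)
    (hq₁G g (Finset.mem_univ g)) n i
  choose h₂ hint₂ hle₂ hnn₂ hbad₂ using fun A : F => hrare₂ Q (S A) (hSm A A.2)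
    (hq₂F A A.2) n i
  set μ : Measure (Fin n → Fin 2 × Valuation J vbar) := Measure.pi fun _ => Q with hμ
  -- `Φ` is at least `1` on every sample that is too poor, so `K * n * Φ` absorbs the largest
  -- possible gain there.
  set Φ : (Fin n → Fin 2 × Valuation J vbar) → ℝ := fun ω => ∑ g, h₁ g ω + ∑ A, h₂ A ω with hΦ
  have hΦi : Integrable Φ μ :=
    (integrable_finsetSum _ fun g _ => hint₁ g).add (integrable_finsetSum _ fun A _ => hint₂ A)
  have hΦ0 : ∀ ω, 0 ≤ Φ ω := fun ω => add_nonneg (Finset.sum_nonneg fun g _ => hnn₁ g ω)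
    (Finset.sum_nonneg fun A _ => hnn₂ A ω)
  have hΦle : ∫ ω, Φ ω ∂μ ≤ 4 * ρ ^ n + F.card * (2 * ρ₂ ^ n) := by
    rw [hΦ, integral_add (integrable_finsetSum _ fun g _ => hint₁ g)
      (integrable_finsetSum _ fun A _ => hint₂ A), integral_finsetSum _ fun g _ => hint₁ g,
      integral_finsetSum _ fun A _ => hint₂ A]
    refine add_le_add ?_ ?_
    · rw [Fin.sum_univ_two]; linarith [hle₁ 0, hle₁ 1]
    · refine (Finset.sum_le_card_nsmul _ _ _ fun A _ => hle₂ A).trans ?_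
      simp
  set Y : Valuation J vbar → (Fin n → Fin 2 × Valuation J vbar) → ℝ := fun r ω =>
    util (v : J → ℝ) (M n (Function.update ω i (z, r)) i) with hY
  have hfeas : ∀ ω, IsFeasible (fun j => c j * n) (M n ω) := fun ω => by
    obtain ⟨g, B, h⟩ := (hM n).2 ω
    exact h.2.1.1
  have hY0 : ∀ r ω, 0 ≤ Y r ω := fun r ω =>
    util_nonneg (fun j => (v.2 j).1.le) fun j => (hfeas _).1 i j
  have hYK : ∀ r ω, Y r ω ≤ K * n := fun r ω =>
    (hfeas _).util_le hvbar.le (fun j => (v.2 j).2) i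
  have hYi : ∀ r, Integrable (Y r) μ := fun r => by
    refine Integrable.of_bound (C := K * n) ?_ (Filter.Eventually.of_forall fun ω => ?_)
    · refine (measurable_util _ ?_).aestronglyMeasurable
      exact (measurable_pi_iff.1 (hM n).1 i).comp measurable_update_left
    · rw [Real.norm_of_nonneg (hY0 r ω)]; exact hYK r ω
  have hpoint : ∀ ω, Y v' ω - Y v ω ≤ ε / 2 + K * n * Φ ω := by
    intro ω
    have hKn : 0 ≤ K * n := mul_nonneg hK0 (Nat.cast_nonneg n)
    by_cases hbad : 1 ≤ Φ ω
    · have h1 := hYK v' ω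
      have h2 := hY0 v ω
      have h3 := mul_le_mul_of_nonneg_left hbad hKn
      linarith
    push Not at hbad
    have hgood₁ : ∀ g, a * n ≤ (othersIn ω i (G g)).card := fun g => by
      by_contra! hlt
      have h1 := hbad₁ g ω hlt
      have h2 := Finset.single_le_sum (f := fun g => h₁ g ω) (fun g _ => hnn₁ g ω)
        (Finset.mem_univ g)
      have h3 := Finset.sum_nonneg fun A (_ : A ∈ Finset.univ) => hnn₂ A ω
      simp only [hΦ] at hbad
      linarith
    have hgood₂ : ∀ A ∈ F, a₂ * n ≤ (othersIn ω i (S A)).card := fun A hA => by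
      by_contra! hlt
      have h1 := hbad₂ ⟨A, hA⟩ ω hlt
      have h2 := Finset.single_le_sum (f := fun A => h₂ A ω) (fun A _ => hnn₂ A ω)
        (Finset.mem_univ (⟨A, hA⟩ : F))
      have h3 := Finset.sum_nonneg fun g (_ : g ∈ Finset.univ) => hnn₁ g ω
      simp only [hΦ] at hbad
      linarith
    have hn' : (0 : ℝ) < n := Nat.cast_pos.2 i.pos
    set ζ : Fin n → Fin 2 := fun k => if k = i then z else (ω k).1 with hζ
    have hclass : ∀ r, (fun k => (Function.update ω i (z, r) k).1) = ζ := fun r => by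
      funext k
      by_cases hk : k = i
      · subst hk; simp [hζ]
      · simp [hζ, hk]
    have hother : ∀ r k, k ≠ i → Function.update ω i (z, r) k = ω k := fun r k hk =>
      Function.update_of_ne hk _ _
    have hspread : ∀ r, IsSpread a δ ζ
        (fun k => ((Function.update ω i (z, r) k).2 : J → ℝ)) := fun r g => by
      refine ⟨othersIn ω i (G g), hgood₁ g, fun k hk => ?_⟩
      obtain ⟨hki, hkG⟩ := mem_othersIn.1 hk
      dsimp only
      rw [hother r k hki]
      exact ⟨by simp only [hζ, hki, if_false]; exact hkG.1, hkG.2⟩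
    -- Both classes occur among the others, so the equal-average requirement is in force whatever
    -- `i` reports.
    have hsurj : Function.Surjective ζ := fun g => by
      obtain ⟨A, hA, hAg⟩ := hspread v g
      obtain ⟨k, hk⟩ := Finset.card_pos.1 (Nat.cast_pos.1 ((mul_pos ha hn').trans_le hA))
      exact ⟨k, (hAg k hk).1⟩
    have heq : ∀ r, ∃ b p, IsEqualized c ζ
        (fun k => ((Function.update ω i (z, r) k).2 : J → ℝ)) b
        (M n (Function.update ω i (z, r))) p := fun r => by
      obtain ⟨g, B, h⟩ := (hM n).2 (Function.update ω i (z, r))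
      rw [hclass r] at h
      exact h.exists_isEqualized hc hsurj fun k j => ((Function.update ω i (z, r) k).2.2 j).1
    obtain ⟨b, p, hE⟩ := heq v
    obtain ⟨b', p', hE'⟩ := heq v'
    have hfin := hN₁ n hn1 ζ (fun k => (Function.update ω i (z, v) k).2)
      (fun k => (Function.update ω i (z, v') k).2) b b' _ _ p p' i hE hE' (hspread v) (hspread v')
      (fun k hk => by rw [hother _ k hk, hother _ k hk]) (fun A hA => by
        refine (hgood₂ A hA).trans (Nat.cast_le.2 (Finset.card_le_card fun k hk => ?_))
        obtain ⟨hki, hkA⟩ := mem_othersIn.1 hk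
        exact mem_othersIn.2 ⟨hki, by rw [hother _ k hki]; exact hkA⟩)
    simp only [Function.update_self] at hfin
    have := mul_nonneg hKn (hΦ0 ω)
    simp only [hY]
    linarith
  have hexp : ∀ r, expectedUtil M Q n i z v r = ∫ ω, Y r ω ∂μ := fun r => rfl
  rw [hexp, hexp, ← integral_sub (hYi v') (hYi v)]
  calc ∫ ω, (Y v' ω - Y v ω) ∂μ ≤ ∫ ω, (ε / 2 + K * n * Φ ω) ∂μ :=
        integral_mono ((hYi v').sub (hYi v)) ((integrable_const _).add (hΦi.const_mul _)) hpoint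
    _ = ε / 2 + K * n * ∫ ω, Φ ω ∂μ := by
        rw [integral_add (integrable_const _) (hΦi.const_mul _), integral_const_mul]
        simp
    _ ≤ ε / 2 + K * n * (4 * ρ ^ n + F.card * (2 * ρ₂ ^ n)) := by
        have := mul_le_mul_of_nonneg_left hΦle (mul_nonneg hK0 (Nat.cast_nonneg n))
        linarith
    _ = ε / 2 + K * (4 * (n * ρ ^ n) + F.card * (2 * (n * ρ₂ ^ n))) := by ring
    _ ≤ ε := by linarith [hN₂ n hn2]

end FairDivision

end

theorem mainTheorem2 {J : Type*} [Fintype J] [Nonempty J] :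
    (∀ (n : ℕ) (s : J → ℝ) (z : Fin n → Fin 2) (v : Fin n → J → ℝ)
        (g : Fin 2) (B : ℝ) (x : Fin n → J → ℝ),
        (∀ j, 0 < s j) → Function.Surjective z → (∀ i j, 0 < v i j) →
        FairDivision.IsCEEqI s z v g B x →
          (∃! p : J → ℝ,
            FairDivision.IsMarketEquilibrium s (FairDivision.groupBudget z g B) v x p) ∧
          FairDivision.NoScaledEnvy z v g B x ∧
          FairDivision.IsParetoOptimal s v x) ∧
    (∀ (vbar : ℝ) (c : J → ℝ) (P : Measure (Fin 2 × FairDivision.Valuation J vbar))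
        (M : FairDivision.Mechanism J vbar),
        (∀ j, 0 < c j) → IsProbabilityMeasure P →
        (P.map Prod.snd).IsOpenPosMeasure →
        (∀ g : Fin 2, 0 < P {t | t.1 = g}) →
        FairDivision.IsCEEqIMechanism c M →
          FairDivision.IsSPL P M) :=
  ⟨fun _ _ _ _ _ _ _ hs hz hv h => h.welfare hs hz hv,
    fun _ _ _ _ hc _ _ hP hM => hM.isSPL hc hP⟩
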